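/- Let $d\ge 1$ and $g\ge 0$ be integers. Let $\epsilon_g(d)$ be the number of ways to glue the sides of a $2d$-gon (with labelled sides) in pairs, the two sides of a pair being identified with opposite orientation, so that the resulting closed orientable surface has genus $g$; equivalently, so that the cell decomposition of the surface that is induced by the polygon has Euler characteristic $V-E+F=2-2g$. Then $$\epsilon_g(d)=\frac{(2d-1)!!\;2^{\,d-2g}}{(d-2g+1)!}\,[u^{2g}]\left(\frac{u}{\sinh u}\right)^{2}\left(\frac{u}{\tanh u}\right)^{d},$$ where $[u^{2g}]$ denotes the coefficient of $u^{2g}$ in the power series expansion at $u=0$, and $1/(d-2g+1)!$ is read as $0$ when $d-2g+1<0$ (that is, $\epsilon_g(d)=0$ when $2g>d+1$). -/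

import Mathlib

open scoped Nat

noncomputable section

namespace HarerZagier

/-! ### Gluing the sides of a polygon in pairs -/

/-- The `2n`-gon: the closed unit disc in `ℂ`, its boundary circle being cut into `2n` sides
by the corners `exp (2πi k / (2n))`. -/
abbrev Polygon : Type := Metric.closedBall (0 : ℂ) 1

/-- The point with parameter `t ∈ [0, 1]` on the side number `i` of the `2n`-gon. The side runs
counterclockwise from the corner number `i` (at `t = 0`) to the next corner (at `t = 1`). -/
def sidePoint (n : ℕ) (i : Fin (2 * n)) (t : ℝ) : Polygon :=
  ⟨Complex.exp (((2 * Real.pi * ((i : ℕ) + t) / (2 * n) : ℝ) : ℂ) * Complex.I), by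
    rw [mem_closedBall_zero_iff, Complex.norm_exp_ofReal_mul_I]⟩

/-- A way of putting the sides of the `2n`-gon in pairs: a permutation of the sides that is an
involution without fixed points. -/
def IsPairing {n : ℕ} (p : Equiv.Perm (Fin (2 * n))) : Prop :=
  (∀ i, p (p i) = i) ∧ ∀ i, p i ≠ i

/-- The elementary identifications: the side `i` is glued to the side `p i` with reversed
direction (so that the orientation of the disc passes to the quotient). -/
def GlueRel {n : ℕ} (p : Equiv.Perm (Fin (2 * n))) (x y : Polygon) : Prop :=
  ∃ i, ∃ t ∈ Set.Icc (0 : ℝ) 1, x = sidePoint n i t ∧ y = sidePoint n (p i) (1 - t)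

/-- The surface obtained by gluing: the quotient space of the polygon by the equivalence relation
generated by the elementary identifications. -/
abbrev Surface {n : ℕ} (p : Equiv.Perm (Fin (2 * n))) : Type := Quot (GlueRel p)

/-- The vertices (0-cells) of the glued surface: the images of the corners. -/
def vertices {n : ℕ} (p : Equiv.Perm (Fin (2 * n))) : Set (Surface p) :=
  Set.range fun i => Quot.mk (GlueRel p) (sidePoint n i 0)

/-- The edges (open 1-cells) of the glued surface: the images of the open sides. -/
def edges {n : ℕ} (p : Equiv.Perm (Fin (2 * n))) : Set (Set (Surface p)) :=
  Set.range fun i => Quot.mk (GlueRel p) '' (sidePoint n i '' Set.Ioo (0 : ℝ) 1)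

/-- The faces (open 2-cells) of the glued surface: there is one, the image of the open disc. -/
def faces {n : ℕ} (p : Equiv.Perm (Fin (2 * n))) : Set (Set (Surface p)) :=
  {Quot.mk (GlueRel p) '' {x : Polygon | ‖(x : ℂ)‖ < 1}}

/-- The Euler characteristic of the glued surface, from its decomposition into cells. -/
def eulerChar {n : ℕ} (p : Equiv.Perm (Fin (2 * n))) : ℤ :=
  (vertices p).ncard - (edges p).ncard + (faces p).ncard

/-- The glued surface (closed, connected and orientable) has genus `g`: its Euler characteristic
is `2 - 2g`. -/
def HasGenus {n : ℕ} (p : Equiv.Perm (Fin (2 * n))) (g : ℕ) : Prop :=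
  eulerChar p = 2 - 2 * (g : ℤ)

/-- `ε_g(n)`: the number of ways of gluing the sides of the `2n`-gon in pairs such that the result
is a surface of genus `g`. -/
def epsilon (g n : ℕ) : ℕ :=
  {p : Equiv.Perm (Fin (2 * n)) | IsPairing p ∧ HasGenus p g}.ncard

/-! ### The power series `u / sinh u` and `u / tanh u` -/

/-- The Taylor series of `sinh` at `0`. -/
def sinhSeries : PowerSeries ℚ := PowerSeries.mk fun k => if Odd k then 1 / (k ! : ℚ) else 0

/-- The Taylor series of `cosh` at `0`. -/
def coshSeries : PowerSeries ℚ := PowerSeries.mk fun k => if Even k then 1 / (k ! : ℚ) else 0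

/-- The power series `sinh u / u`, obtained by shifting the coefficients of `sinh u`. -/
def sinhDivX : PowerSeries ℚ := PowerSeries.mk fun k => PowerSeries.coeff (k + 1) sinhSeries

/-- The power series `u / sinh u`. -/
def xDivSinh : PowerSeries ℚ := sinhDivX⁻¹

/-- The power series `u / tanh u = (u / sinh u) * cosh u`. -/
def xDivTanh : PowerSeries ℚ := xDivSinh * coshSeries

theorem sinhDivX_mul_X : sinhDivX * PowerSeries.X = sinhSeries := by
  ext k
  cases k with
  | zero => simp [sinhSeries]
  | succ k => simp [sinhDivX, PowerSeries.coeff_succ_mul_X]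

theorem xDivSinh_mul_sinhDivX : xDivSinh * sinhDivX = 1 := by
  apply PowerSeries.inv_mul_cancel
  simp [sinhDivX, sinhSeries, ← PowerSeries.coeff_zero_eq_constantCoeff_apply]

theorem xDivSinh_mul_sinh : xDivSinh * sinhSeries = PowerSeries.X := by
  rw [← sinhDivX_mul_X, ← mul_assoc, xDivSinh_mul_sinhDivX, one_mul]

theorem xDivTanh_mul_sinh : xDivTanh * sinhSeries = PowerSeries.X * coshSeries := by
  rw [xDivTanh, mul_right_comm, xDivSinh_mul_sinh]

end HarerZagier

end

/-! Corners are identified exactly along the cycles of `finRotate * p`, and the glued surface has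
`d` edges and one face; hence genus `g` means that this permutation has `d + 1 - 2g` cycles
(`hasGenus_iff`). It remains to compute the polynomial `∑ N ^ cycleCount (finRotate * p)` over all
pairings `p`.

By conjugation invariance, `p` may be fixed and the full cycle `γ` varied instead
(`card_mul_transitiveCycleSum_eq`). Full cycles are singled out by the polynomial `∑_I (-t)^|I|
sign(γ|_I) = det(1 - tγ) = ∏ (1 - t^ℓ)`, where `I` runs over the stable subsets and `ℓ` over the
cycle lengths: its derivative at `t = 1` vanishes unless there is a single cycle
(`sum_card_sub_mul_restrictSign`). After exchanging sums, the sum over `γ` for fixed `I` vanishes if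
`I` contains two points whose partners lie outside `I`; otherwise it reduces to a falling times a
rising factorial. Summing over `I` yields `(2d-1)!! [X^N] X (1+X)^d / (1-X)^(d+2)`
(`sum_pow_cycleCount_finRotate_mul`).

The substitution `X = e^(-2u)` in the residue for this coefficient suggests `½ [u^(d+1)] e^(2Nu)
(u/sinh u)² (u/tanh u)^d`; the equality is proved by a common recurrence
(`coeff_X_mul_pow_mul_geomSeries_pow`). Expanding the exponential and comparing powers of `N` gives
the formula. -/

namespace HarerZagier

open Equiv Equiv.Perm Finset

/-! ### Cycle counts and their generating functions over a symmetric group. -/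

/-- The number of cycles of a permutation, fixed points included. -/
noncomputable def cycleCount {α : Type*} (σ : Perm α) : ℕ :=
  Nat.card (Quotient (SameCycle.setoid σ))

theorem sameCycle_permCongr {α β : Type*} (e : α ≃ β) (σ : Perm α) (a b : α) :
    SameCycle (e.permCongr σ) (e a) (e b) ↔ SameCycle σ a b := by
  have key : ∀ k : ℤ, (e.permCongr σ ^ k) (e a) = e ((σ ^ k) a) := by
    intro k
    have := map_zpow (Equiv.permCongrHom e) σ k
    have h2 := DFunLike.congr_fun this (e a)
    simpa using h2.symm
  simp only [SameCycle, key, e.injective.eq_iff]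

theorem cycleCount_permCongr {α β : Type*} (e : α ≃ β) (σ : Perm α) :
    cycleCount (e.permCongr σ) = cycleCount σ := by
  refine (Nat.card_congr (Quotient.congr e fun a b => ?_)).symm
  exact (sameCycle_permCongr e σ a b).symm

theorem cycleCount_conj {α : Type*} (g σ : Perm α) :
    cycleCount (g * σ * g⁻¹) = cycleCount σ :=
  cycleCount_permCongr g σ

theorem cycleCount_sumCongr {α β : Type*} [Finite α] [Finite β] (σ : Perm α) (τ : Perm β) :
    cycleCount (Perm.sumCongr σ τ) = cycleCount σ + cycleCount τ := by
  have hz : ∀ k : ℤ, Perm.sumCongr σ τ ^ k = Perm.sumCongr (σ ^ k) (τ ^ k) := fun k =>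
    (map_zpow (Perm.sumCongrHom α β) (σ, τ) k).symm
  rw [cycleCount, cycleCount, cycleCount, ← Nat.card_sum]
  have hl : ∀ a b, SameCycle (Perm.sumCongr σ τ) (Sum.inl a) (Sum.inl b) ↔ SameCycle σ a b := by
    intro a b; simp [SameCycle, hz]
  have hr : ∀ a b, SameCycle (Perm.sumCongr σ τ) (Sum.inr a) (Sum.inr b) ↔ SameCycle τ a b := by
    intro a b; simp [SameCycle, hz]
  refine Nat.card_congr ⟨Quotient.lift (Sum.map (Quotient.mk (SameCycle.setoid σ))
      (Quotient.mk (SameCycle.setoid τ))) ?_,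
    Sum.elim (Quotient.map Sum.inl fun a b h => (hl a b).2 h)
      (Quotient.map Sum.inr fun a b h => (hr a b).2 h), ?_, ?_⟩
  · rintro (a | a) (b | b) h
    · exact congrArg Sum.inl (Quotient.sound ((hl a b).1 h))
    · obtain ⟨k, hk⟩ := h; simp [hz] at hk
    · obtain ⟨k, hk⟩ := h; simp [hz] at hk
    · exact congrArg Sum.inr (Quotient.sound ((hr a b).1 h))
  · rintro ⟨a | a⟩ <;> rfl
  · rintro (a | a) <;> induction a using Quotient.inductionOn <;> rfl

theorem cycleCount_subtypeCongr {α : Type*} [Finite α] {p : α → Prop} [DecidablePred p]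
    (σ : Perm {a // p a}) (τ : Perm {a // ¬ p a}) :
    cycleCount (σ.subtypeCongr τ) = cycleCount σ + cycleCount τ := by
  rw [Perm.subtypeCongr, cycleCount_permCongr, cycleCount_sumCongr]

theorem cycleCount_of_unique {α : Type*} [Unique α] (σ : Perm α) : cycleCount σ = 1 := by
  have : Unique (Quotient (SameCycle.setoid σ)) := Quotient.instUniqueQuotient _
  exact Nat.card_unique

theorem cycleCount_of_isEmpty {α : Type*} [IsEmpty α] (σ : Perm α) : cycleCount σ = 0 := by
  simp [cycleCount]

theorem cycleCount_optionCongr {α : Type*} [Finite α] (σ : Perm α) :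
    cycleCount (Equiv.optionCongr σ) = cycleCount σ + 1 := by
  rw [← cycleCount_of_unique (1 : Perm PUnit.{1}), ← cycleCount_sumCongr,
    ← cycleCount_permCongr (Equiv.optionEquivSumPUnit α)]
  congr 1
  ext (x | x) <;> simp

/-- If the new orbit of `x` avoided `y`, it would follow the old one forever; but the old one
returns to `x`, and there the transposition diverts it to `y`. -/
theorem sameCycle_swap_mul_self {α : Type*} [DecidableEq α] [Finite α] {σ : Perm α} {x y : α}
    (h : ¬ SameCycle σ x y) : SameCycle (swap x y * σ) x y := by
  by_contra hc
  have key : ∀ j : ℕ, ((swap x y * σ) ^ j) x = (σ ^ j) x := by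
    intro j
    induction j with
    | zero => rfl
    | succ j ih =>
      have hs : ((swap x y * σ) ^ (j + 1)) x = swap x y ((σ ^ (j + 1)) x) := by
        rw [pow_succ', Perm.mul_apply, ih, pow_succ' σ, Perm.mul_apply, Perm.mul_apply]
      rw [hs]
      apply swap_apply_of_ne_of_ne
      · intro he
        rw [he, swap_apply_left] at hs
        exact hc ⟨(j + 1 : ℕ), by rw [zpow_natCast, hs]⟩
      · intro he
        exact h ⟨(j + 1 : ℕ), by rw [zpow_natCast, he]⟩
  obtain ⟨j, hj⟩ : ∃ j : ℕ, σ ^ (j + 1) = 1 :=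
    ⟨orderOf σ - 1, by rw [Nat.sub_add_cancel (orderOf_pos σ), pow_orderOf_eq_one]⟩
  have h1 := key (j + 1)
  rw [pow_succ', Perm.mul_apply, key j, Perm.mul_apply, ← Perm.mul_apply σ, ← pow_succ', hj] at h1
  rw [Perm.one_apply, swap_apply_left] at h1
  exact h (h1 ▸ SameCycle.refl _ _)

theorem SameCycle.induction_map {α β : Type*} {σ : Perm α} {f : α → β}
    (hf : ∀ a, f (σ a) = f a) {a b : α} (h : SameCycle σ a b) : f a = f b := by
  obtain ⟨k, rfl⟩ := h
  induction k with
  | zero => rfl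
  | succ k ih => rw [add_comm, zpow_add, Perm.mul_apply, zpow_one, hf, ← ih]
  | pred k ih =>
    rw [ih, ← hf ((σ ^ (-(k : ℤ) - 1)) a), ← Perm.mul_apply, ← zpow_one_add]
    congr 3; ring

/-- The transposition merges the cycles of `x` and `y` and leaves the others unchanged as sets. -/
theorem cycleCount_swap_mul {α : Type*} [DecidableEq α] [Finite α] {σ : Perm α} {x y : α}
    (h : ¬ SameCycle σ x y) : cycleCount (swap x y * σ) + 1 = cycleCount σ := by
  classical
  set w := swap x y * σ with hw
  have hxy : SameCycle w x y := sameCycle_swap_mul_self h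
  let Q := Quotient (SameCycle.setoid σ)
  let mk : α → Q := Quotient.mk (SameCycle.setoid σ)
  have hmk : ∀ a, mk (σ a) = mk a := fun a => Quotient.sound (s := SameCycle.setoid σ)
    (sameCycle_apply_left.2 (SameCycle.refl _ _))
  have hne : mk x ≠ mk y := fun he => h (Quotient.exact (s := SameCycle.setoid σ) he)
  have hto : ∀ a b, SameCycle σ a b → SameCycle w a b := by
    intro a b hab
    have := SameCycle.induction_map (f := Quotient.mk (SameCycle.setoid w)) (σ := σ) ?_ hab
    · exact Quotient.exact (s := SameCycle.setoid w) this
    · intro c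
      apply Quotient.sound (s := SameCycle.setoid w)
      change SameCycle w (σ c) c
      have h1 : SameCycle w (w c) c := sameCycle_apply_left.2 (SameCycle.refl _ _)
      have hwc : w c = swap x y (σ c) := rfl
      by_cases h2 : σ c = x
      · rw [hwc, h2, swap_apply_left] at h1
        rw [h2]; exact hxy.trans h1
      by_cases h3 : σ c = y
      · rw [hwc, h3, swap_apply_right] at h1
        rw [h3]; exact hxy.symm.trans h1
      rwa [hwc, swap_apply_of_ne_of_ne h2 h3] at h1
  -- The merged cycle is represented by the old class of `x`, so the new classes correspond to the
  -- old ones other than that of `y`.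
  let f : α → Q := fun a => if mk a = mk y then mk x else mk a
  have hf : ∀ a, f (w a) = f a := by
    intro a
    have hwa : w a = swap x y (σ a) := rfl
    by_cases h2 : σ a = x
    · have : mk a = mk x := by rw [← hmk a, h2]
      simp [f, hwa, h2, this, hne]
    by_cases h3 : σ a = y
    · have : mk a = mk y := by rw [← hmk a, h3]
      simp [f, hwa, h3, this]
    rw [hwa, swap_apply_of_ne_of_ne h2 h3]
    simp only [f, hmk]
  have hfy : ∀ a, f a ≠ mk y := by
    intro a
    simp only [f]
    split_ifs with h4
    · exact hne
    · exact h4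
  let e : Quotient (SameCycle.setoid w) ≃ {q : Q // q ≠ mk y} :=
    { toFun := Quotient.lift (fun a => ⟨f a, hfy a⟩) fun a b hab =>
        Subtype.ext (SameCycle.induction_map hf hab)
      invFun := fun q => Quotient.map id hto q.1
      left_inv := by
        rintro ⟨a⟩
        change Quotient.map id hto (f a) = Quotient.mk _ a
        simp only [f]
        split_ifs with h4
        · apply Quotient.sound (s := SameCycle.setoid w)
          exact hxy.trans (hto _ _ (Quotient.exact (s := SameCycle.setoid σ) h4)).symm
        · rfl
      right_inv := by
        rintro ⟨⟨a⟩, ha⟩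
        apply Subtype.ext
        change f a = mk a
        exact if_neg ha }
  have : Fintype Q := Fintype.ofFinite _
  have hpos : 0 < Fintype.card Q := Fintype.card_pos_iff.2 ⟨mk x⟩
  rw [cycleCount, Nat.card_congr e, cycleCount, Nat.card_eq_fintype_card, Nat.card_eq_fintype_card]
  change Fintype.card {q : Q // ¬ q = mk y} + 1 = Fintype.card Q
  rw [Fintype.card_subtype_compl, Fintype.card_subtype_eq]
  omega

theorem sum_perm_option {α M : Type*} [DecidableEq α] [Fintype α] [AddCommMonoid M]
    (F : Perm (Option α) → M) :
    ∑ σ, F σ = ∑ σ : Perm α, (F (Equiv.optionCongr σ) +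
      ∑ a : α, F (swap none (some a) * Equiv.optionCongr σ)) := by
  rw [← Equiv.sum_comp Perm.decomposeOption.symm, Fintype.sum_prod_type_right]
  refine Finset.sum_congr rfl fun σ _ => ?_
  rw [Fintype.sum_option]
  simp [Perm.decomposeOption]
  rfl

theorem not_sameCycle_optionCongr {α : Type*} (σ : Perm α) (a : α) :
    ¬ SameCycle (Equiv.optionCongr σ) none (some a) := by
  intro h
  have := SameCycle.induction_map (f := Option.isSome) (by rintro (_ | x) <;> simp) h
  simp at this

theorem cycleCount_swap_mul_optionCongr {α : Type*} [DecidableEq α] [Finite α] (σ : Perm α)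
    (a : α) : cycleCount (swap none (some a) * Equiv.optionCongr σ) = cycleCount σ := by
  have := cycleCount_swap_mul (not_sameCycle_optionCongr σ a)
  rw [cycleCount_optionCongr] at this
  omega

/-- A point added to `k` points either forms a new cycle, with weight `N`, or is inserted in one of
`k` places into an existing cycle: a factor `N + k`. -/
theorem sum_pow_cycleCount (α : Type) [DecidableEq α] [Fintype α] (N : ℕ) :
    ∑ σ : Perm α, (N : ℤ) ^ cycleCount σ = (N.ascFactorial (Fintype.card α) : ℤ) := by
  induction h : Fintype.card α generalizing α with
  | zero =>
    have := Fintype.card_eq_zero_iff.1 h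
    simp [cycleCount_of_isEmpty]
  | succ k ih =>
    obtain ⟨e⟩ : Nonempty (α ≃ Option (Fin k)) := ⟨Fintype.equivOfCardEq (by simp [h])⟩
    rw [← Equiv.sum_comp e.permCongr.symm]
    simp only [Equiv.permCongr_symm, cycleCount_permCongr]
    rw [sum_perm_option]
    simp only [cycleCount_optionCongr, cycleCount_swap_mul_optionCongr, Finset.sum_const,
      Finset.card_univ, Fintype.card_fin, pow_succ, nsmul_eq_mul]
    simp only [Nat.ascFactorial_succ]
    push_cast
    rw [← ih (Fin k) (by simp), Finset.mul_sum]
    exact Finset.sum_congr rfl fun σ _ => by ring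

/-- As without signs, but each of the `k` insertions reverses the sign: a factor `N - k`. -/
theorem sum_sign_mul_pow_cycleCount (α : Type) [DecidableEq α] [Fintype α] (N : ℕ) :
    ∑ σ : Perm α, (sign σ : ℤ) * (N : ℤ) ^ cycleCount σ =
      (N.descFactorial (Fintype.card α) : ℤ) := by
  induction h : Fintype.card α generalizing α with
  | zero =>
    have := Fintype.card_eq_zero_iff.1 h
    simp [cycleCount_of_isEmpty]
  | succ k ih =>
    obtain ⟨e⟩ : Nonempty (α ≃ Option (Fin k)) := ⟨Fintype.equivOfCardEq (by simp [h])⟩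
    rw [← Equiv.sum_comp e.permCongr.symm]
    simp only [Equiv.permCongr_symm, cycleCount_permCongr, sign_permCongr]
    have hs : ∀ a : Fin k, sign (swap none (some a)) = -1 := fun a =>
      sign_swap (Option.some_ne_none a).symm
    rw [sum_perm_option]
    simp only [cycleCount_optionCongr, cycleCount_swap_mul_optionCongr, Finset.sum_const,
      Finset.card_univ, Fintype.card_fin, pow_succ, nsmul_eq_mul, Perm.sign_mul, optionCongr_sign,
      hs]
    rw [Nat.descFactorial_succ]
    -- Truncated subtraction is harmless: for `k > N` the falling factorial is already zero.
    have hk : (((N - k : ℕ) : ℤ)) * (N.descFactorial k : ℤ) = ((N : ℤ) - k) * N.descFactorial k := by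
      rcases le_or_gt k N with h1 | h1
      · rw [Nat.cast_sub h1]
      · simp [Nat.descFactorial_of_lt h1]
    rw [Nat.cast_mul, hk, ← ih (Fin k) (by simp), Finset.mul_sum]
    refine Finset.sum_congr rfl fun σ _ => ?_
    push_cast
    ring

end HarerZagier

/-! ### Signs on stable subsets and the detection of full cycles. -/

namespace HarerZagier

open Equiv Equiv.Perm Finset

/-- The sign of the restriction of `γ` to `I` if `I` is stable under `γ`, and `0` otherwise. -/
def restrictSign {α : Type*} [DecidableEq α] (γ : Perm α) (I : Finset α) [Fintype α] : ℤ :=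
  if h : ∀ x, γ x ∈ I ↔ x ∈ I then (sign (γ.subtypePerm h : Perm {x // x ∈ I}) : ℤ) else 0

theorem swap_stable_of_mem {α : Type*} [DecidableEq α] {I : Finset α} {x y : α}
    (hx : x ∈ I) (hy : y ∈ I) (z : α) :
    swap x y z ∈ I ↔ z ∈ I := by
  rw [swap_apply_def]; split_ifs <;> simp_all

theorem swap_stable_of_notMem {α : Type*} [DecidableEq α] {I : Finset α} {x y : α}
    (hx : x ∉ I) (hy : y ∉ I) (z : α) :
    swap x y z ∈ I ↔ z ∈ I := by
  rw [swap_apply_def]; split_ifs <;> simp_all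

section RestrictSign

variable {α : Type*} [DecidableEq α] [Fintype α] {γ δ : Perm α} {I : Finset α}

theorem restrictSign_of_stable (h : ∀ x, γ x ∈ I ↔ x ∈ I) :
    restrictSign γ I = (sign (γ.subtypePerm h : Perm {x // x ∈ I}) : ℤ) := dif_pos h

theorem restrictSign_eq_sign_ofSubtype (h : ∀ x, γ x ∈ I ↔ x ∈ I) :
    restrictSign γ I = (sign (ofSubtype (γ.subtypePerm h : Perm {x // x ∈ I})) : ℤ) := by
  rw [restrictSign_of_stable h, sign_ofSubtype]

theorem restrictSign_mul_of_stable_left (h : ∀ x, γ x ∈ I ↔ x ∈ I) :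
    restrictSign (γ * δ) I = restrictSign γ I * restrictSign δ I := by
  by_cases hd : ∀ x, δ x ∈ I ↔ x ∈ I
  · have hm : ∀ x, (γ * δ) x ∈ I ↔ x ∈ I := fun x => (h _).trans (hd x)
    rw [restrictSign_of_stable h, restrictSign_of_stable hd, restrictSign_of_stable hm,
      ← Units.val_mul, ← Int.cast_id (n := (_ : ℤˣ).val), ← Perm.sign_mul]
    rfl
  · have hm : ¬ ∀ x, (γ * δ) x ∈ I ↔ x ∈ I := fun hm => hd fun x => (h _).symm.trans (hm x)
    rw [restrictSign, dif_neg hm, restrictSign, restrictSign, dif_neg hd, mul_zero]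

theorem restrictSign_mul_of_stable_right (h : ∀ x, δ x ∈ I ↔ x ∈ I) :
    restrictSign (γ * δ) I = restrictSign γ I * restrictSign δ I := by
  by_cases hd : ∀ x, γ x ∈ I ↔ x ∈ I
  · exact restrictSign_mul_of_stable_left hd
  · have hm : ¬ ∀ x, (γ * δ) x ∈ I ↔ x ∈ I := fun hm => hd fun x => by
      obtain ⟨z, rfl⟩ := δ.surjective x
      exact (hm z).trans (h z).symm
    rw [restrictSign, dif_neg hm, restrictSign, restrictSign, dif_neg hd, zero_mul]

theorem restrictSign_swap_of_mem {x y : α} (hx : x ∈ I) (hy : y ∈ I) (hxy : x ≠ y) :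
    restrictSign (swap x y) I = -1 := by
  rw [restrictSign_eq_sign_ofSubtype (swap_stable_of_mem hx hy)]
  have : ofSubtype ((swap x y).subtypePerm (swap_stable_of_mem hx hy) : Perm {x // x ∈ I}) =
      swap x y := by
    apply ofSubtype_subtypePerm
    intro z hz
    by_contra hzI
    apply hz
    apply swap_apply_of_ne_of_ne <;> rintro rfl <;> contradiction
  rw [this, sign_swap hxy]; rfl

theorem restrictSign_swap_of_notMem {x y : α} (hx : x ∉ I) (hy : y ∉ I) :
    restrictSign (swap x y) I = 1 := by
  rw [restrictSign_of_stable (swap_stable_of_notMem hx hy)]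
  have : ((swap x y).subtypePerm (swap_stable_of_notMem hx hy) : Perm {x // x ∈ I}) = 1 := by
    ext ⟨z, hz⟩
    simp only [subtypePerm_apply, Perm.one_apply]
    apply swap_apply_of_ne_of_ne <;> rintro rfl <;> contradiction
  rw [this]; simp

theorem restrictSign_empty : restrictSign γ ∅ = 1 := by
  rw [restrictSign_of_stable (by simp)]
  have : (γ.subtypePerm (by simp) : Perm {x // x ∈ (∅ : Finset α)}) = 1 := by
    ext ⟨z, hz⟩; simp at hz
  rw [this]; simp

/-- The finset of elements in the cycle of `y`. -/
def cycleFinset (γ : Perm α) (y : α) : Finset α := by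
  classical exact {z | SameCycle γ y z}

theorem mem_cycleFinset {y z : α} : z ∈ cycleFinset γ y ↔ SameCycle γ y z := by
  simp [cycleFinset]

theorem cycleFinset_stable (y z : α) : γ z ∈ cycleFinset γ y ↔ z ∈ cycleFinset γ y := by
  simp [mem_cycleFinset]

theorem sign_cycleOf_mul_neg_one_pow (y : α) :
    (sign (γ.cycleOf y) : ℤ) * (-1) ^ #(cycleFinset γ y) = -1 := by
  by_cases hy : γ y = y
  · have h1 : cycleFinset γ y = {y} := by
      ext z
      rw [mem_cycleFinset, mem_singleton]
      refine ⟨fun h => ?_, fun h => h ▸ SameCycle.refl _ _⟩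
      exact ((Perm.SameCycle.eq_of_left h hy)).symm
    rw [h1, (cycleOf_eq_one_iff γ).2 hy]; simp
  · have hc := isCycle_cycleOf γ hy
    have h1 : cycleFinset γ y = (γ.cycleOf y).support := by
      ext z
      rw [mem_cycleFinset, mem_support_cycleOf_iff' hy]
    rw [h1, hc.sign]
    push_cast
    rw [neg_mul, ← mul_pow]; simp

/-- A cycle of length `ℓ` has sign `(-1)^(ℓ-1)`, so adjoining it multiplies the weight by `(-1)^ℓ
(-1)^(ℓ-1) = -1`. -/
theorem neg_one_pow_mul_restrictSign_union {y : α} (hI : Disjoint I (cycleFinset γ y)) :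
    (-1) ^ #(I ∪ cycleFinset γ y) * restrictSign γ (I ∪ cycleFinset γ y) =
      -((-1) ^ #I * restrictSign γ I) := by
  set C := cycleFinset γ y with hC
  have hCs : ∀ z, γ z ∈ C ↔ z ∈ C := cycleFinset_stable y
  by_cases h : ∀ x, γ x ∈ I ↔ x ∈ I
  · have hu : ∀ x, γ x ∈ I ∪ C ↔ x ∈ I ∪ C := fun x => by simp only [mem_union, h, hCs]
    rw [restrictSign_eq_sign_ofSubtype h, restrictSign_eq_sign_ofSubtype hu,
      card_union_of_disjoint hI]
    have : ofSubtype (γ.subtypePerm hu : Perm {x // x ∈ I ∪ C}) =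
        ofSubtype (γ.subtypePerm h : Perm {x // x ∈ I}) * γ.cycleOf y := by
      ext z
      rw [Perm.mul_apply, cycleOf_apply]
      have hz : SameCycle γ y z ↔ z ∈ C := mem_cycleFinset.symm
      by_cases h1 : z ∈ C
      · have h2 : γ z ∉ I := fun h3 => disjoint_left.1 hI h3 ((hCs z).2 h1)
        rw [if_pos (hz.2 h1), ofSubtype_apply_of_mem _ (mem_union_right _ h1),
          ofSubtype_apply_of_not_mem _ h2]
        rfl
      · rw [if_neg (fun h3 => h1 (hz.1 h3))]
        by_cases h2 : z ∈ I
        · rw [ofSubtype_apply_of_mem _ (mem_union_left _ h2), ofSubtype_apply_of_mem _ h2]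
          rfl
        · rw [ofSubtype_apply_of_not_mem _ h2, ofSubtype_apply_of_not_mem]
          simp [h1, h2]
    rw [this, Perm.sign_mul, pow_add, Units.val_mul]
    have := sign_cycleOf_mul_neg_one_pow (γ := γ) y
    linear_combination ((-1) ^ #I * (sign (ofSubtype (γ.subtypePerm h : Perm {x // x ∈ I})) : ℤ)) *
      this
  · have hu : ¬ ∀ x, γ x ∈ I ∪ C ↔ x ∈ I ∪ C := fun hu => h fun x => by
      have h1 := hu x
      have h2 := hCs x
      have h3 : x ∈ I → x ∉ C := fun hx => disjoint_left.1 hI hx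
      have h4 : γ x ∈ I → γ x ∉ C := fun hx => disjoint_left.1 hI hx
      rw [mem_union, mem_union] at h1
      tauto
    rw [restrictSign, dif_neg hu, restrictSign, dif_neg h]; simp

/-- Stable sets are unions of cycles. If some cycle `C` misses `x`, toggling `C` is a sign-reversing
involution on the sets avoiding `x`; otherwise only the empty set contributes. -/
theorem sum_neg_one_pow_mul_restrictSign (γ : Perm α) (x : α) :
    ∑ I with x ∉ I, (-1) ^ #I * restrictSign γ I =
      open Classical in if ∀ y, SameCycle γ x y then 1 else 0 := by
  classical
  split_ifs with hx
  · rw [Finset.sum_eq_single ∅]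
    · simp [restrictSign_empty]
    · intro I hI hne
      have hxI : x ∉ I := by simpa using hI
      rw [restrictSign, dif_neg, mul_zero]
      intro h
      obtain ⟨y, hy⟩ := Finset.nonempty_iff_ne_empty.2 hne
      have := SameCycle.induction_map (f := fun z => z ∈ I) (fun a => propext (h a)) (hx y)
      simp only [eq_iff_iff] at this
      exact hxI (this.2 hy)
    · simp
  · push Not at hx
    obtain ⟨y, hy⟩ := hx
    set C := cycleFinset γ y with hC
    have hxC : x ∉ C := fun h => hy (mem_cycleFinset.1 h).symm
    have hyC : y ∈ C := mem_cycleFinset.2 (SameCycle.refl _ _)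
    have hstab : ∀ I : Finset α, (∀ z, γ z ∈ I ↔ z ∈ I) → Disjoint I C ∨ C ⊆ I := by
      intro I hI
      have hm : ∀ z ∈ C, (y ∈ I ↔ z ∈ I) := fun z hz => by
        have := SameCycle.induction_map (f := fun z => z ∈ I) (fun a => propext (hI a))
          (mem_cycleFinset.1 hz)
        simpa using this
      by_cases hyI : y ∈ I
      · exact Or.inr fun z hz => (hm z hz).1 hyI
      · exact Or.inl (disjoint_left.2 fun z hz hzC => hyI ((hm z hzC).2 hz))
    have hadd : ∀ I : Finset α, (∀ z, γ z ∈ I ↔ z ∈ I) → (-1) ^ #I * restrictSign γ I +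
        (-1) ^ #(symmDiff I C) * restrictSign γ (symmDiff I C) = 0 := by
      intro I hI
      rcases hstab I hI with h | h
      · have := neg_one_pow_mul_restrictSign_union h
        rw [h.symmDiff_eq_sup, sup_eq_union, this]; ring
      · have hd : Disjoint (I \ C) C := sdiff_disjoint
        have := neg_one_pow_mul_restrictSign_union hd
        rw [← hC, sdiff_union_of_subset h] at this
        rw [this, symmDiff_def, sup_eq_union, sdiff_eq_empty_iff_subset.2 h, union_empty]; ring
    refine Finset.sum_involution (fun I _ => symmDiff I C) ?_ ?_ ?_ ?_
    · intro I _
      by_cases hI : ∀ z, γ z ∈ I ↔ z ∈ I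
      · exact hadd I hI
      · have hI' : ¬ ∀ z, γ z ∈ symmDiff I C ↔ z ∈ symmDiff I C := fun h => hI fun z => by
          have h1 := h z
          have h2 : γ z ∈ C ↔ z ∈ C := cycleFinset_stable y z
          simp only [mem_symmDiff] at h1
          tauto
        rw [restrictSign, dif_neg hI, restrictSign, dif_neg hI']; simp
    · intro I _ _ he
      have : y ∈ symmDiff I C ↔ y ∈ I := by rw [he]
      simp only [mem_symmDiff] at this
      tauto
    · intro I hI
      have hxI : x ∉ I := by simpa using hI
      simp [mem_symmDiff, hxI, hxC]
    · intro I _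
      simp

/-- The factor `card α - #I` counts the points `x ∉ I`; the sum over `I` for a fixed `x` is already
known. -/
theorem sum_card_sub_mul_restrictSign (γ : Perm α) :
    ∑ I : Finset α, ((Fintype.card α : ℤ) - #I) * ((-1) ^ #I * restrictSign γ I) =
      open Classical in if ∀ x y, SameCycle γ x y then (Fintype.card α : ℤ) else 0 := by
  classical
  have h1 : ∀ I : Finset α, ((Fintype.card α : ℤ) - #I) * ((-1) ^ #I * restrictSign γ I) =
      ∑ x, if x ∉ I then ((-1) ^ #I * restrictSign γ I) else 0 := by
    intro I
    rw [← Finset.sum_filter, Finset.sum_const, nsmul_eq_mul, ← Finset.compl_filter,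
      Finset.card_compl, Nat.cast_sub (Finset.card_le_univ _)]
    simp
  rw [Finset.sum_congr rfl fun I _ => h1 I, Finset.sum_comm]
  rw [Finset.sum_congr rfl fun x _ =>
    (Finset.sum_filter _ _).symm.trans (sum_neg_one_pow_mul_restrictSign γ x)]
  have h2 : ∀ x, (∀ y, SameCycle γ x y) ↔ ∀ x y, SameCycle γ x y :=
    fun x => ⟨fun h a b => (h a).symm.trans (h b), fun h => h x⟩
  by_cases h : ∀ x y, SameCycle γ x y
  · rw [if_pos h, Finset.sum_congr rfl fun x _ => if_pos ((h2 x).2 h)]; simp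
  · rw [if_neg h, Finset.sum_congr rfl fun x _ => if_neg (fun h' => h ((h2 x).1 h'))]; simp

end RestrictSign

end HarerZagier

/-! ### Signed cycle sums for a fixed subset. -/

namespace HarerZagier

open Equiv Equiv.Perm Finset

section SignedSum

variable {α : Type} [DecidableEq α]

theorem subtypeCongr_stable {I : Finset α} (σ : Perm {x // x ∈ I}) (τ : Perm {x // ¬ x ∈ I})
    (x : α) : σ.subtypeCongr τ x ∈ I ↔ x ∈ I := by
  by_cases hx : x ∈ I
  · rw [Perm.subtypeCongr.left_apply _ _ hx]; simp [hx]
  · rw [Perm.subtypeCongr.right_apply _ _ hx]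
    exact iff_of_false (τ ⟨x, hx⟩).2 hx

variable [Fintype α]

/-- The sum of `N ^ (number of cycles of p * γ)` over the `γ` stabilizing `I`, weighted by the sign of
the restriction to `I`. -/
noncomputable def signedCycleSum (p : Perm α) (N : ℕ) (I : Finset α) : ℤ :=
  ∑ γ : Perm α, restrictSign γ I * (N : ℤ) ^ cycleCount (p * γ)

theorem restrictSign_subtypeCongr {I : Finset α} (σ : Perm {x // x ∈ I})
    (τ : Perm {x // ¬ x ∈ I}) : restrictSign (σ.subtypeCongr τ) I = sign σ := by
  rw [restrictSign_of_stable (subtypeCongr_stable σ τ)]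
  congr 2
  ext ⟨x, hx⟩
  simp [Perm.subtypeCongr.left_apply _ _ hx]

/-- Only permutations that split as `σ` on `I` and `τ` off `I` contribute, so the sum factors into a
signed and an unsigned one. -/
theorem signedCycleSum_one (N : ℕ) (I : Finset α) :
    signedCycleSum 1 N I =
      N.descFactorial #I * N.ascFactorial (Fintype.card α - #I) := by
  have h1 : Fintype.card {x // x ∈ I} = #I := Fintype.card_coe I
  have h2 : Fintype.card {x // ¬ x ∈ I} = Fintype.card α - #I := by
    rw [Fintype.card_subtype_compl, h1]
  rw [← h1, ← sum_sign_mul_pow_cycleCount, h1, ← h2, ← sum_pow_cycleCount, Finset.sum_mul_sum,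
    ← Finset.sum_product', signedCycleSum]
  symm
  refine Finset.sum_of_injOn (fun q => q.1.subtypeCongr q.2)
    (Perm.subtypeCongrHom_injective (· ∈ I)).injOn (fun _ _ => by simp) ?_ ?_
  · intro γ _ hγ
    rw [restrictSign, dif_neg, zero_mul]
    intro h
    refine hγ ⟨(γ.subtypePerm h, γ.subtypePerm fun x => not_congr (h x)), by simp, ?_⟩
    ext x
    by_cases hx : x ∈ I
    · simp [Perm.subtypeCongr.left_apply _ _ hx]
    · simp [Perm.subtypeCongr.right_apply _ _ hx]
  · rintro ⟨σ, τ⟩ _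
    rw [restrictSign_subtypeCongr, one_mul, cycleCount_subtypeCongr, pow_add]
    ring

variable {p : Perm α}

theorem restrictSign_of_involutive (hp : ∀ x, p (p x) = x) {I : Finset α}
    (h : ∀ x, p x ∈ I ↔ x ∈ I) :
    restrictSign p I = (-1) ^ ((#I - #{x ∈ I | p x = x}) / 2) := by
  rw [restrictSign_of_stable h, sign_of_pow_two_eq_one]
  · rw [Fintype.card_coe]
    push_cast
    congr 3
    rw [← Fintype.card_coe]
    refine Fintype.card_congr ⟨fun x => ⟨x.1.1, ?_⟩, fun x => ⟨⟨x.1, ?_⟩, ?_⟩, fun _ => rfl,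
      fun _ => rfl⟩
    · have := x.2
      simp only [Function.mem_fixedPoints, Function.IsFixedPt] at this
      exact mem_filter.2 ⟨x.1.2, congrArg Subtype.val this⟩
    · exact (mem_filter.1 x.2).1
    · exact Subtype.ext (mem_filter.1 x.2).2
  · ext x
    simp [pow_two, hp]

/-- Substituting `γ = p * v` removes `p` from the cycle count and extracts its sign on `I`, one
factor `-1` for each pair in `I`. -/
theorem signedCycleSum_of_stable (hp : ∀ x, p (p x) = x) (hp' : ∀ x, p x ≠ x) {I : Finset α}
    (h : ∀ x, p x ∈ I ↔ x ∈ I) (N : ℕ) :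
    signedCycleSum p N I = (-1) ^ (#I / 2) *
      (N.descFactorial #I * N.ascFactorial (Fintype.card α - #I)) := by
  have hpp : p * p = 1 := by ext x; simp [hp]
  have hf : #{x ∈ I | p x = x} = 0 := by simp [hp']
  have hs := restrictSign_of_involutive hp h
  rw [hf, Nat.sub_zero] at hs
  rw [← signedCycleSum_one, ← hs, signedCycleSum, ← Equiv.sum_comp (Equiv.mulLeft p),
    signedCycleSum, Finset.mul_sum]
  refine Finset.sum_congr rfl fun v _ => ?_
  rw [Equiv.coe_mulLeft, restrictSign_mul_of_stable_left h, ← mul_assoc p, hpp, mul_assoc]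

/-- The substitution `γ ↦ swap (p x) (p y) * γ * swap x y` conjugates `p * γ` by `swap x y`, so it
preserves the cycle count; on `I` only the second transposition acts, and it reverses the sign. -/
theorem signedCycleSum_eq_zero (hp : ∀ x, p (p x) = x) {I : Finset α} {x y : α} (hxy : x ≠ y)
    (hx : x ∈ I) (hy : y ∈ I) (hpx : p x ∉ I) (hpy : p y ∉ I) (N : ℕ) :
    signedCycleSum p N I = 0 := by
  have hsum : signedCycleSum p N I = -signedCycleSum p N I := by
    rw [signedCycleSum, ← Finset.sum_neg_distrib]
    conv_lhs => rw [← Equiv.sum_comp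
      ((Equiv.mulLeft (swap (p x) (p y))).trans (Equiv.mulRight (swap x y)))]
    refine Finset.sum_congr rfl fun γ _ => ?_
    simp only [Equiv.trans_apply, Equiv.coe_mulLeft, Equiv.coe_mulRight]
    rw [restrictSign_mul_of_stable_right (swap_stable_of_mem hx hy),
      restrictSign_mul_of_stable_left (swap_stable_of_notMem hpx hpy),
      restrictSign_swap_of_mem hx hy hxy, restrictSign_swap_of_notMem hpx hpy]
    have h1 : p * swap (p x) (p y) = swap x y * p := by
      rw [Equiv.mul_swap_eq_swap_mul, hp, hp]
    have h2 : p * (swap (p x) (p y) * γ * swap x y) = swap x y * (p * γ) * (swap x y)⁻¹ := by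
      rw [swap_inv, ← mul_assoc, ← mul_assoc, h1]; simp only [mul_assoc]
    rw [h2, cycleCount_conj]
    ring
  omega

/-- After `γ = β * v`, the product `p * γ` is `swap y (p y) * v`. When `v` stabilizes `I`, it has
`y` and `p y` in different cycles, and the transposition merges them; the factor `N` on the left
compensates for the lost cycle. -/
theorem mul_signedCycleSum_of_unpaired (hp : ∀ x, p (p x) = x) (hp' : ∀ x, p x ≠ x)
    {I : Finset α} {y : α} (hy : y ∈ I) (hpy : p y ∉ I)
    (h : ∀ x ∈ I, x ≠ y → p x ∈ I) (hI : Odd #I) (N : ℕ) :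
    N * signedCycleSum p N I = (-1) ^ (#I / 2) *
      (N.descFactorial #I * N.ascFactorial (Fintype.card α - #I)) := by
  have hpp : p * p = 1 := by ext x; simp [hp]
  -- `β` is `p` with the pair `{y, p y}` turned into two fixed points, which makes `I` stable.
  set β : Perm α := p * swap y (p y) with hβ
  have hβy : β y = y := by simp [hβ, hp]
  have hβz : β (p y) = p y := by simp [hβ]
  have hβx : ∀ x, x ≠ y → x ≠ p y → β x = p x := fun x h1 h2 => by
    rw [hβ, Perm.mul_apply, swap_apply_of_ne_of_ne h1 h2]
  have hβs : ∀ x, β x ∈ I ↔ x ∈ I := by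
    intro x
    by_cases h1 : x = y
    · rw [h1, hβy]
    by_cases h2 : x = p y
    · rw [h2, hβz]
    rw [hβx x h1 h2]
    refine ⟨fun h3 => ?_, fun h3 => h x h3 h1⟩
    have := h (p x) h3 (fun h4 => h2 (by rw [← h4, hp]))
    rwa [hp] at this
  have hβi : ∀ x, β (β x) = x := by
    intro x
    by_cases h1 : x = y
    · rw [h1, hβy, hβy]
    by_cases h2 : x = p y
    · rw [h2, hβz, hβz]
    rw [hβx x h1 h2, hβx, hp]
    · intro h4; exact h2 (by rw [← h4, hp])
    · intro h4; exact h1 (p.injective h4)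
  have hf : {x ∈ I | β x = x} = {y} := by
    ext x
    rw [mem_filter, mem_singleton]
    constructor
    · rintro ⟨h1, h2⟩
      by_contra h3
      rw [hβx x h3 (fun h4 => hpy (h4 ▸ h1))] at h2
      exact hp' x h2
    · rintro rfl
      exact ⟨hy, hβy⟩
  have hs := restrictSign_of_involutive hβi hβs
  have hodd : (#I - 1) / 2 = #I / 2 := by
    obtain ⟨r, hr⟩ := hI
    omega
  rw [hf, card_singleton, hodd] at hs
  rw [← signedCycleSum_one, ← hs, signedCycleSum, ← Equiv.sum_comp (Equiv.mulLeft β),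
    signedCycleSum, Finset.mul_sum, Finset.mul_sum]
  refine Finset.sum_congr rfl fun v _ => ?_
  rw [Equiv.coe_mulLeft, restrictSign_mul_of_stable_left hβs, ← mul_assoc p, hβ, ← mul_assoc p,
    hpp, one_mul, one_mul]
  by_cases hv : ∀ x, v x ∈ I ↔ x ∈ I
  · have hc : ¬ SameCycle v y (p y) := fun hc => by
      have := SameCycle.induction_map (f := fun z => z ∈ I) (fun a => propext (hv a)) hc
      simp only [eq_iff_iff] at this
      exact hpy (this.1 hy)
    rw [← cycleCount_swap_mul hc, pow_succ]
    ring
  · have : restrictSign v I = 0 := dif_neg hv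
    simp [this]

end SignedSum

end HarerZagier

/-! ### The sum over subsets for the standard pairing on `ι × Bool`. -/

namespace HarerZagier

open Equiv Equiv.Perm Finset

section Flip

variable {ι : Type} [DecidableEq ι] [Fintype ι]

/-- The involution of `ι × Bool` that exchanges the two elements over each point of `ι`. -/
def flip (ι : Type) : Perm (ι × Bool) := Equiv.prodCongr (Equiv.refl ι) Equiv.boolNot

omit [DecidableEq ι] [Fintype ι] in
theorem flip_apply (i : ι) (b : Bool) : flip ι (i, b) = (i, !b) := rfl

omit [DecidableEq ι] [Fintype ι] in
theorem flip_flip (x : ι × Bool) : flip ι (flip ι x) = x := by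
  obtain ⟨i, b⟩ := x; simp [flip_apply]

omit [DecidableEq ι] [Fintype ι] in
theorem flip_ne (x : ι × Bool) : flip ι x ≠ x := by
  obtain ⟨i, b⟩ := x; simp [flip_apply]

theorem signedCycleSum_flip_of_pairs (J : Finset ι) (N : ℕ) :
    signedCycleSum (flip ι) N (J ×ˢ univ) = (-1) ^ #J *
      (N.descFactorial (2 * #J) * N.ascFactorial (2 * Fintype.card ι - 2 * #J)) := by
  rw [signedCycleSum_of_stable flip_flip flip_ne (by rintro ⟨i, b⟩; simp [flip_apply])]
  have h1 : #(J ×ˢ (univ : Finset Bool)) = 2 * #J := by simp [mul_comm]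
  rw [h1, Nat.mul_div_cancel_left _ two_pos, Fintype.card_prod, Fintype.card_bool,
    mul_comm (Fintype.card ι)]

omit [Fintype ι] in
theorem card_insert_pairs {y : ι × Bool} {J : Finset ι} (hy : y.1 ∉ J) :
    #(insert y (J ×ˢ (univ : Finset Bool))) = 2 * #J + 1 := by
  rw [card_insert_of_notMem (by simp [mem_product, hy])]; simp [mul_comm]

theorem mul_signedCycleSum_flip_insert {y : ι × Bool} {J : Finset ι} (hy : y.1 ∉ J) (N : ℕ) :
    N * signedCycleSum (flip ι) N (insert y (J ×ˢ univ)) = (-1) ^ #J *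
      (N.descFactorial (2 * #J + 1) * N.ascFactorial (2 * Fintype.card ι - (2 * #J + 1))) := by
  have h1 := card_insert_pairs hy
  rw [mul_signedCycleSum_of_unpaired flip_flip flip_ne (y := y) (mem_insert_self _ _), h1]
  · rw [Fintype.card_prod, Fintype.card_bool, mul_comm (Fintype.card ι)]
    congr 2
    omega
  · obtain ⟨i, b⟩ := y
    simp only at hy
    simp [flip_apply, hy]
  · rintro ⟨j, c⟩ hx hne
    rw [mem_insert] at hx ⊢
    right
    rcases hx with hx | hx
    · exact absurd hx hne
    · simpa [flip_apply] using hx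
  · rw [h1]; exact odd_two_mul_add_one _

/-- Only sets with at most one unpaired element survive: unions of pairs, possibly with one extra
point `y` from another pair. -/
theorem sum_eq_sum_pairs_add_sum_insert {F : Finset (ι × Bool) → ℤ}
    (hF : ∀ I, ∀ x ∈ I, ∀ y ∈ I, x ≠ y → flip ι x ∉ I → flip ι y ∉ I → F I = 0) :
    ∑ I, F I = ∑ J : Finset ι, F (J ×ˢ univ) +
      ∑ y : ι × Bool, ∑ J ∈ (univ.erase y.1).powerset, F (insert y (J ×ˢ univ)) := by
  classical
  rw [← Finset.sum_filter_add_sum_filter_not univ (fun I => ∀ x ∈ I, flip ι x ∈ I)]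
  congr 1
  · symm
    refine Finset.sum_nbij' (fun J => J ×ˢ univ) (fun I => I.image Prod.fst) ?_ ?_ ?_ ?_ ?_
    · intro J _
      simp [flip_apply]
    · simp
    · intro J _
      ext i; simp
    · intro I hI
      have hI := (mem_filter.1 hI).2
      ext ⟨i, b⟩
      simp only [mem_product, mem_image, mem_univ, and_true, Prod.exists, exists_and_right,
        exists_eq_right]
      refine ⟨fun ⟨c, hc⟩ => ?_, fun h => ⟨b, h⟩⟩
      by_cases hbc : b = c
      · rwa [hbc]
      · have := hI _ hc
        rw [flip_apply] at this
        rwa [(Bool.eq_not_of_ne hbc : b = !c)]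
    · simp
  · rw [Finset.sum_sigma']
    symm
    refine Finset.sum_of_injOn (fun q => insert q.1 (q.2 ×ˢ univ)) ?_ ?_ ?_ (fun _ _ => rfl)
    · rintro ⟨⟨i, b⟩, J⟩ h ⟨⟨i', b'⟩, J'⟩ h' he
      have hi : i ∉ J := by
        have := (mem_sigma.1 h).2
        rw [mem_powerset] at this
        intro hh; simpa using this hh
      have hi' : i' ∉ J' := by
        have := (mem_sigma.1 h').2
        rw [mem_powerset] at this
        intro hh; simpa using this hh
      have key : ∀ j c, ((j, c) = (i, b) ∨ j ∈ J) ↔ ((j, c) = (i', b') ∨ j ∈ J') := by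
        intro j c
        have := congrArg (fun s : Finset (ι × Bool) => (j, c) ∈ s) he
        simpa using this
      have h1 : (i, b) = (i', b') := by
        by_contra hne
        have h2 : i ∈ J' := ((key i b).1 (Or.inl rfl)).resolve_left hne
        have h3 := ((key i (!b)).2 (Or.inr h2)).resolve_right hi
        simp at h3
      have h2 : J = J' := by
        simp only [Prod.mk.injEq] at h1
        ext j
        have := key j (!b)
        simpa [h1.1, h1.2] using this
      simp only [Prod.mk.injEq] at h1
      obtain ⟨rfl, rfl⟩ := h1
      rw [h2]
    · rintro ⟨⟨i, b⟩, J⟩ h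
      have hi : i ∉ J := by
        have := (mem_sigma.1 h).2
        rw [mem_powerset] at this
        intro hh; simpa using this hh
      simp only [coe_filter, mem_univ, true_and, Set.mem_ofPred_eq, not_forall]
      exact ⟨(i, b), mem_insert_self _ _, by simp [flip_apply, hi]⟩
    · intro I hI hn
      have hI := (mem_filter.1 hI).2
      push Not at hI
      obtain ⟨y, hy, hpy⟩ := hI
      by_cases hu : ∃ x ∈ I, x ≠ y ∧ flip ι x ∉ I
      · obtain ⟨x, hx, hxy, hpx⟩ := hu
        exact hF I x hx y hy hxy hpx hpy
      · exfalso
        push Not at hu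
        refine hn ⟨⟨y, (I.erase y).image Prod.fst⟩, ?_, ?_⟩
        · obtain ⟨i, b⟩ := y
          simp only [coe_sigma, coe_univ, Set.mem_sigma_iff, Set.mem_univ, true_and, mem_coe,
            mem_powerset]
          intro j hj
          obtain ⟨⟨j', c⟩, hjc, rfl⟩ := mem_image.1 hj
          rw [mem_erase] at hjc
          rw [mem_erase]
          refine ⟨fun hji => ?_, mem_univ _⟩
          simp only at hji
          subst hji
          by_cases hcb : c = b
          · exact hjc.1 (by rw [hcb])
          · rw [flip_apply, ← (Bool.eq_not_of_ne hcb : c = !b)] at hpy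
            exact hpy hjc.2
        · ext ⟨j, c⟩
          simp only [mem_insert, mem_product, mem_univ, and_true, mem_image, mem_erase]
          constructor
          · rintro (h | ⟨⟨j', c'⟩, ⟨h1, h2⟩, rfl⟩)
            · rw [h]; exact hy
            · by_cases hc : c = c'
              · rw [hc]; exact h2
              · have := hu _ h2 h1
                rwa [flip_apply, ← (Bool.eq_not_of_ne hc : c = !c')] at this
          · intro h
            by_cases h1 : (j, c) = y
            · exact Or.inl h1
            · exact Or.inr ⟨(j, c), ⟨h1, h⟩, rfl⟩

/-- The sum of `N ^ (number of cycles of p * γ)` over the `γ` that are cycles through all points. -/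
noncomputable def transitiveCycleSum {α : Type} [DecidableEq α] [Fintype α] (p : Perm α) (N : ℕ) : ℤ :=
  open Classical in ∑ γ : Perm α with ∀ x y, SameCycle γ x y, (N : ℤ) ^ cycleCount (p * γ)

theorem card_mul_transitiveCycleSum {α : Type} [DecidableEq α] [Fintype α] (p : Perm α) (N : ℕ) :
    Fintype.card α * transitiveCycleSum p N =
      ∑ I : Finset α, ((Fintype.card α : ℤ) - #I) * ((-1) ^ #I * signedCycleSum p N I) := by
  classical
  simp only [signedCycleSum, Finset.mul_sum]
  rw [Finset.sum_comm, transitiveCycleSum, Finset.sum_filter, Finset.mul_sum]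
  refine Finset.sum_congr rfl fun γ _ => ?_
  have := sum_card_sub_mul_restrictSign γ
  have h2 : ∀ I : Finset α, ((Fintype.card α : ℤ) - #I) *
      ((-1) ^ #I * (restrictSign γ I * (N : ℤ) ^ cycleCount (p * γ))) =
      (((Fintype.card α : ℤ) - #I) * ((-1) ^ #I * restrictSign γ I)) *
        (N : ℤ) ^ cycleCount (p * γ) := fun I => by ring
  simp only [h2]
  rw [← Finset.sum_mul, this]
  split_ifs <;> simp

/-- Subsets are grouped by their number `j` of full pairs. The factor `2 * (k + 1)` before the
second sum counts the unpaired points, and its minus sign comes from the odd cardinality `2j + 1`.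
-/
theorem mul_card_mul_transitiveCycleSum_flip (k N : ℕ) :
    N * ((2 * (k + 1) : ℕ) * transitiveCycleSum (flip (Fin (k + 1))) N) =
      N * ∑ j ∈ range (k + 2), ((k + 1).choose j : ℤ) * (((2 * (k + 1) : ℕ) - 2 * j) * ((-1) ^ j *
        (N.descFactorial (2 * j) * N.ascFactorial (2 * (k + 1) - 2 * j)))) -
      (2 * (k + 1) : ℕ) * ∑ j ∈ range (k + 1), (k.choose j : ℤ) * (((2 * (k + 1) : ℕ) - (2 * j + 1)) *
        ((-1) ^ j * (N.descFactorial (2 * j + 1) * N.ascFactorial (2 * (k + 1) - (2 * j + 1))))) := by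
  have hc : Fintype.card (Fin (k + 1) × Bool) = 2 * (k + 1) := by simp [mul_comm]
  have h0 := card_mul_transitiveCycleSum (flip (Fin (k + 1))) N
  rw [hc] at h0
  rw [h0, sum_eq_sum_pairs_add_sum_insert, mul_add, sub_eq_add_neg]
  · congr 1
    · congr 1
      rw [← Finset.powerset_univ]
      have := Finset.sum_powerset_apply_card (x := (univ : Finset (Fin (k + 1))))
        (fun j => ((2 * (k + 1) : ℕ) - 2 * (j : ℤ)) * ((-1) ^ j *
          ((N.descFactorial (2 * j) : ℤ) * N.ascFactorial (2 * (k + 1) - 2 * j))))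
      simp only [card_univ, Fintype.card_fin, nsmul_eq_mul] at this
      rw [← this]
      refine Finset.sum_congr rfl fun J _ => ?_
      have h1 : #(J ×ˢ (univ : Finset Bool)) = 2 * #J := by simp [mul_comm]
      rw [signedCycleSum_flip_of_pairs, h1, Fintype.card_fin, pow_mul]
      push_cast
      simp
    · rw [Finset.mul_sum, ← mul_neg, ← Finset.sum_neg_distrib]
      have h2 : ∀ y : Fin (k + 1) × Bool, N * ∑ J ∈ (univ.erase y.1).powerset,
          (((2 * (k + 1) : ℕ) : ℤ) - #(insert y (J ×ˢ (univ : Finset Bool)))) *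
            ((-1) ^ #(insert y (J ×ˢ (univ : Finset Bool))) *
              signedCycleSum (flip (Fin (k + 1))) N (insert y (J ×ˢ univ))) =
          ∑ j ∈ range (k + 1), -((k.choose j : ℤ) * (((2 * (k + 1) : ℕ) - (2 * j + 1)) *
            ((-1) ^ j * (N.descFactorial (2 * j + 1) *
              N.ascFactorial (2 * (k + 1) - (2 * j + 1)))))) := by
        intro y
        have := Finset.sum_powerset_apply_card (x := (univ : Finset (Fin (k + 1))).erase y.1)
          (fun j => -(((2 * (k + 1) : ℕ) - (2 * (j : ℤ) + 1)) * ((-1) ^ j *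
            ((N.descFactorial (2 * j + 1) : ℤ) * N.ascFactorial (2 * (k + 1) - (2 * j + 1))))))
        simp only [card_erase_of_mem (mem_univ y.1), card_univ, Fintype.card_fin, nsmul_eq_mul,
          Nat.add_sub_cancel, mul_neg] at this
        rw [← this, Finset.mul_sum]
        refine Finset.sum_congr rfl fun J hJ => ?_
        have hy : y.1 ∉ J := fun hh => by simpa using (mem_powerset.1 hJ) hh
        have h3 := mul_signedCycleSum_flip_insert hy N
        rw [Fintype.card_fin] at h3
        rw [← h3, card_insert_pairs hy, pow_succ, pow_mul]
        push_cast
        ring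
      rw [Finset.sum_congr rfl fun y _ => h2 y, Finset.sum_const, card_univ, hc, nsmul_eq_mul]
  · intro I x hx y hy hxy hpx hpy
    rw [signedCycleSum_eq_zero flip_flip hxy hx hy hpx hpy]; simp

end Flip

end HarerZagier

/-! ### Closed form through a rational generating function. -/

namespace HarerZagier

open Equiv Equiv.Perm Finset

section GeneratingFunction

open PowerSeries

/-- The geometric series `1 / (1 - X)`. -/
noncomputable def geomSeries : PowerSeries ℚ := PowerSeries.mk 1

theorem geomSeries_mul : geomSeries * (1 - X) = 1 := mk_one_mul_one_sub_eq_one ℚ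

theorem derivative_geomSeries : d⁄dX ℚ geomSeries = geomSeries ^ 2 := by
  have h := congrArg (d⁄dX ℚ) geomSeries_mul
  simp only [Derivation.leibniz, map_sub, derivative_X, Derivation.map_one_eq_zero,
    smul_eq_mul] at h
  linear_combination geomSeries * h - d⁄dX ℚ geomSeries * geomSeries_mul

/-- The two products overlap only in the factor `N`; the rest is a product of `m` consecutive
integers, namely `m!` times a binomial coefficient. -/
theorem descFactorial_mul_ascFactorial {N m q : ℕ} (hN : 0 < N) (hq : q ≤ m + 1) :
    (N.descFactorial q * N.ascFactorial (m + 1 - q) : ℚ) =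
      N * m ! * coeff N (X ^ q * geomSeries ^ (m + 1)) := by
  rw [geomSeries, mk_one_pow_eq_mk_choose_add, coeff_X_pow_mul']
  split_ifs with h
  · rw [coeff_mk]
    have h1 : ((N - q)! * N.descFactorial q : ℚ) = N ! := by
      exact_mod_cast Nat.factorial_mul_descFactorial h
    have h2 : ((N - 1)! * N.ascFactorial (m + 1 - q) : ℚ) = (N + (m + 1 - q) - 1)! := by
      exact_mod_cast Nat.factorial_mul_ascFactorial' N (m + 1 - q) hN
    have h3 : ((m + (N - q)).choose m * m ! * (N - q)! : ℚ) = (m + (N - q))! := by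
      rw [Nat.choose_symm_add]
      exact_mod_cast Nat.add_choose_mul_factorial_mul_factorial m (N - q)
    have h4 : (N ! : ℚ) = N * (N - 1)! := by
      exact_mod_cast (Nat.mul_factorial_pred hN.ne').symm
    have h5 : N + (m + 1 - q) - 1 = m + (N - q) := by omega
    rw [h5, ← h3] at h2
    rw [h4] at h1
    have p1 : ((N - q)! : ℚ) ≠ 0 := by positivity
    have p2 : ((N - 1)! : ℚ) ≠ 0 := by positivity
    apply mul_left_cancel₀ (mul_ne_zero p1 p2)
    linear_combination (N.ascFactorial (m + 1 - q) * (N - 1)! : ℚ) * h1 + (N * (N - 1)! : ℚ) * h2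
  · rw [Nat.descFactorial_of_lt (by omega)]; simp

theorem derivative_one_sub_sq_pow (k : ℕ) :
    d⁄dX ℚ ((1 - X ^ 2 : PowerSeries ℚ) ^ k) * (1 - X ^ 2) =
      -(2 * (k : ℚ⟦X⟧) * X * (1 - X ^ 2) ^ k) := by
  cases k with
  | zero => simp
  | succ k =>
    rw [Derivation.leibniz_pow]
    simp only [map_sub, Derivation.leibniz_pow, derivative_X, Derivation.map_one_eq_zero,
      smul_eq_mul, Nat.add_sub_cancel, nsmul_eq_mul]
    push_cast
    ring

theorem one_sub_sq_pow_eq_sum (k : ℕ) : (1 - X ^ 2 : PowerSeries ℚ) ^ k =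
    ∑ j ∈ range (k + 1), (k.choose j : PowerSeries ℚ) * ((-1) ^ j * (X : ℚ⟦X⟧) ^ (2 * j)) := by
  rw [sub_eq_neg_add, add_pow]
  refine Finset.sum_congr rfl fun j _ => ?_
  rw [neg_pow, ← pow_mul]
  ring

/-- Absorption, `(k+1-j) C(k+1,j) = (k+1) C(k,j)`, followed by the binomial theorem. -/
theorem sum_choose_mul_sub (k : ℕ) :
    ∑ j ∈ range (k + 2), ((k + 1).choose j : PowerSeries ℚ) *
      ((2 * ((k : ℚ⟦X⟧) + 1) - 2 * (j : ℚ⟦X⟧)) * ((-1) ^ j * (X : ℚ⟦X⟧) ^ (2 * j))) =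
      2 * ((k : ℚ⟦X⟧) + 1) * (1 - X ^ 2) ^ k := by
  rw [Finset.sum_range_succ, one_sub_sq_pow_eq_sum, Finset.mul_sum]
  push_cast
  rw [sub_self, zero_mul, mul_zero, add_zero]
  refine Finset.sum_congr rfl fun j hj => ?_
  have hj : j ≤ k := by simpa [Nat.lt_succ_iff] using hj
  have h : ((k + 1 : ℕ) * k.choose j : PowerSeries ℚ) = (k + 1).choose j * (k + 1 - j : ℕ) := by
    rw [← Nat.cast_mul, ← Nat.cast_mul, ← Nat.choose_mul_succ_eq, mul_comm]
  rw [Nat.cast_sub (by omega)] at h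
  push_cast at h
  linear_combination (-2) * ((-1) ^ j * (X : PowerSeries ℚ) ^ (2 * j)) * h

/-- The weight is `2k + 1 - 2j`, and the part `2j` is produced by differentiating `X^(2j)`. -/
theorem sum_choose_mul_sub_odd (k : ℕ) :
    ∑ j ∈ range (k + 1), (k.choose j : PowerSeries ℚ) *
      ((2 * ((k : ℚ⟦X⟧) + 1) - (2 * (j : ℚ⟦X⟧) + 1)) * ((-1) ^ j * (X : ℚ⟦X⟧) ^ (2 * j + 1))) =
      (2 * (k : ℚ⟦X⟧) + 1) * X * (1 - X ^ 2) ^ k - X ^ 2 * d⁄dX ℚ ((1 - X ^ 2) ^ k) := by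
  rw [one_sub_sq_pow_eq_sum, map_sum, Finset.mul_sum, Finset.mul_sum, ← Finset.sum_sub_distrib]
  refine Finset.sum_congr rfl fun j hj => ?_
  have h1 : d⁄dX ℚ ((k.choose j : PowerSeries ℚ) * ((-1) ^ j * (X : ℚ⟦X⟧) ^ (2 * j))) =
      (k.choose j : PowerSeries ℚ) * ((-1) ^ j * (((2 * j : ℕ) : ℚ⟦X⟧) * (X : ℚ⟦X⟧) ^ (2 * j - 1))) := by
    have h2 : (k.choose j : PowerSeries ℚ) * ((-1) ^ j * (X : ℚ⟦X⟧) ^ (2 * j)) =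
      ((k.choose j : ℚ) * (-1) ^ j) • (X : ℚ⟦X⟧) ^ (2 * j) := by
      rw [PowerSeries.smul_eq_C_mul]
      simp [mul_assoc]
    rw [h2, Derivation.map_smul, Derivation.leibniz_pow, derivative_X, PowerSeries.smul_eq_C_mul]
    simp [mul_assoc]
  rw [h1]
  rcases Nat.eq_zero_or_pos j with rfl | hj
  · simp; ring
  · obtain ⟨i, rfl⟩ := Nat.exists_eq_add_of_lt hj
    have : 2 * (0 + i + 1) - 1 = 2 * i + 1 := by omega
    rw [this]
    push_cast
    ring

theorem generatingFunction_identity (k : ℕ) :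
    X * d⁄dX ℚ ((1 - X ^ 2) ^ k * geomSeries ^ (2 * k + 2)) -
      ((2 * (k : ℚ⟦X⟧) + 1) * X * (1 - X ^ 2) ^ k - X ^ 2 * d⁄dX ℚ ((1 - X ^ 2) ^ k)) *
        geomSeries ^ (2 * k + 2) = X * (1 + X) ^ (k + 1) * geomSeries ^ (k + 3) := by
  have hV := geomSeries_mul
  have hR : X * (1 + X) ^ (k + 1) * geomSeries ^ (k + 3) =
      X * (1 + X) * (1 - X ^ 2) ^ k * geomSeries ^ (2 * k + 3) := by
    have h1 : (1 - X ^ 2 : PowerSeries ℚ) = (1 - X) * (1 + X) := by ring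
    have h2 : (geomSeries * (1 - X)) ^ k = 1 := by rw [hV, one_pow]
    rw [mul_pow] at h2
    rw [h1, mul_pow]
    linear_combination (-X * (1 + X) ^ (k + 1) * geomSeries ^ (k + 3)) * h2
  have hm : geomSeries ^ (2 * k + 2) = geomSeries ^ (2 * k + 3) * (1 - X) := by
    linear_combination (-geomSeries ^ (2 * k + 2)) * hV
  have hD := derivative_one_sub_sq_pow k
  have hW : d⁄dX ℚ (geomSeries ^ (2 * k + 2)) = (2 * (k : ℚ⟦X⟧) + 2) * geomSeries ^ (2 * k + 3) := by
    rw [Derivation.leibniz_pow, derivative_geomSeries, Nat.add_succ_sub_one, nsmul_eq_mul,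
      smul_eq_mul]
    push_cast
    ring
  rw [hR, Derivation.leibniz, hW, hm]
  simp only [smul_eq_mul]
  linear_combination X * geomSeries ^ (2 * k + 3) * hD

theorem transitiveCycleSum_flip (k : ℕ) {N : ℕ} (hN : 0 < N) :
    (transitiveCycleSum (flip (Fin (k + 1))) N : ℚ) =
      (2 * k + 1)! * coeff N (X * (1 + X) ^ (k + 1) * geomSeries ^ (k + 3)) := by
  have h := congrArg (Int.cast (R := ℚ)) (mul_card_mul_transitiveCycleSum_flip k N)
  push_cast at h
  have e1 : ∀ j ∈ range (k + 2), ((k + 1).choose j : ℚ) * ((2 * (k + 1) - 2 * j) * ((-1) ^ j *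
      (N.descFactorial (2 * j) * N.ascFactorial (2 * (k + 1) - 2 * j)))) =
      N * (2 * k + 1)! * coeff N ((((k + 1).choose j : PowerSeries ℚ) *
      ((2 * ((k : ℚ⟦X⟧) + 1) - 2 * (j : ℚ⟦X⟧)) * ((-1) ^ j * (X : ℚ⟦X⟧) ^ (2 * j)))) * geomSeries ^ (2 * k + 2)) := by
    intro j hj
    have hj : j < k + 2 := by simpa using hj
    have h1 := descFactorial_mul_ascFactorial (m := 2 * k + 1) (q := 2 * j) hN (by omega)
    rw [show 2 * k + 1 + 1 = 2 * (k + 1) by ring] at h1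
    rw [h1]
    have h2 : (((k + 1).choose j : PowerSeries ℚ) * ((2 * ((k : ℚ⟦X⟧) + 1) - 2 * (j : ℚ⟦X⟧)) * ((-1) ^ j *
        (X : ℚ⟦X⟧) ^ (2 * j)))) * geomSeries ^ (2 * k + 2) =
        C ((k + 1).choose j * ((2 * (k + 1) - 2 * j) * (-1) ^ j) : ℚ) *
          ((X : ℚ⟦X⟧) ^ (2 * j) * geomSeries ^ (2 * (k + 1))) := by
      simp only [map_mul, map_sub, map_pow, map_neg, map_one, map_natCast, map_add, map_ofNat]
      ring
    rw [h2, coeff_C_mul]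
    ring
  have e2 : ∀ j ∈ range (k + 1), (k.choose j : ℚ) * ((2 * (k + 1) - (2 * j + 1)) * ((-1) ^ j *
      (N.descFactorial (2 * j + 1) * N.ascFactorial (2 * (k + 1) - (2 * j + 1))))) =
      N * (2 * k + 1)! * coeff N (((k.choose j : PowerSeries ℚ) *
      ((2 * ((k : ℚ⟦X⟧) + 1) - (2 * (j : ℚ⟦X⟧) + 1)) * ((-1) ^ j * (X : ℚ⟦X⟧) ^ (2 * j + 1)))) *
        geomSeries ^ (2 * k + 2)) := by
    intro j hj
    have hj : j < k + 1 := by simpa using hj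
    have h1 := descFactorial_mul_ascFactorial (m := 2 * k + 1) (q := 2 * j + 1) hN (by omega)
    rw [show 2 * k + 1 + 1 = 2 * (k + 1) by ring] at h1
    rw [h1]
    have h2 : ((k.choose j : PowerSeries ℚ) * ((2 * ((k : ℚ⟦X⟧) + 1) - (2 * (j : ℚ⟦X⟧) + 1)) * ((-1) ^ j *
        (X : ℚ⟦X⟧) ^ (2 * j + 1)))) * geomSeries ^ (2 * k + 2) =
        C (k.choose j * ((2 * (k + 1) - (2 * j + 1)) * (-1) ^ j) : ℚ) *
          ((X : ℚ⟦X⟧) ^ (2 * j + 1) * geomSeries ^ (2 * (k + 1))) := by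
      simp only [map_mul, map_sub, map_pow, map_neg, map_one, map_natCast, map_add, map_ofNat]
      ring
    rw [h2, coeff_C_mul]
    ring
  rw [Finset.sum_congr rfl e1, Finset.sum_congr rfl e2, ← Finset.mul_sum, ← Finset.mul_sum,
    ← map_sum, ← map_sum, ← Finset.sum_mul, ← Finset.sum_mul, sum_choose_mul_sub,
    sum_choose_mul_sub_odd] at h
  have hN' : (N : ℚ) ≠ 0 := by positivity
  -- The extra factor `N` in the even sum is absorbed by the operator `X d/dX`.
  have hder : (N : ℚ) * coeff N ((1 - X ^ 2) ^ k * geomSeries ^ (2 * k + 2)) =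
      coeff N (X * d⁄dX ℚ ((1 - X ^ 2) ^ k * geomSeries ^ (2 * k + 2))) := by
    obtain ⟨M, rfl⟩ := Nat.exists_eq_add_of_lt hN
    rw [zero_add, coeff_succ_X_mul, coeff_derivative]
    push_cast; ring
  have h2 : (2 * ((k : PowerSeries ℚ) + 1) * (1 - X ^ 2) ^ k * geomSeries ^ (2 * k + 2)) =
      C (2 * ((k : ℚ) + 1)) * ((1 - X ^ 2) ^ k * geomSeries ^ (2 * k + 2)) := by
    simp only [map_mul, map_add, map_one, map_natCast, map_ofNat]; ring
  rw [h2, coeff_C_mul] at h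
  rw [← generatingFunction_identity, map_sub, ← hder]
  have hk : (2 * ((k : ℚ) + 1)) ≠ 0 := by positivity
  apply mul_left_cancel₀ (mul_ne_zero hN' hk)
  linear_combination h

end GeneratingFunction

end HarerZagier

/-! ### Exchanging the roles of the pairing and the full cycle. -/

namespace HarerZagier

open Equiv Equiv.Perm Finset

/-- Each conjugate of `a` is reached by the elements of one coset of the centralizer. -/
theorem sum_conj_eq_card_centralizer_mul {G M : Type*} [Group G] [Fintype G] [DecidableEq G]
    [CommSemiring M] (a : G) (F : G → M) :
    open Classical in ∑ g : G, F (g * a * g⁻¹) =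
      Nat.card (Subgroup.centralizer {a}) * ∑ b with IsConj a b, F b := by
  classical
  rw [← Finset.sum_fiberwise_of_maps_to (s := univ) (t := {b | IsConj a b})
    (g := fun g => g * a * g⁻¹) (fun g _ => by
      simp only [mem_filter, mem_univ, true_and]; exact isConj_iff.2 ⟨g, rfl⟩), Finset.mul_sum]
  refine Finset.sum_congr rfl fun b hb => ?_
  obtain ⟨h, rfl⟩ := isConj_iff.1 (mem_filter.1 hb).2
  have h1 : ∀ g ∈ ({g | g * a * g⁻¹ = h * a * h⁻¹} : Finset G),
      F (g * a * g⁻¹) = F (h * a * h⁻¹) := fun g hg => by rw [(mem_filter.1 hg).2]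
  rw [Finset.sum_congr rfl h1, Finset.sum_const, nsmul_eq_mul]
  congr 2
  rw [← Fintype.card_coe, ← Nat.card_eq_fintype_card]
  refine Nat.card_congr ⟨fun g => ⟨h⁻¹ * g.1, ?_⟩, fun c => ⟨h * c.1, ?_⟩, fun g => ?_, fun c => ?_⟩
  · have := (mem_filter.1 g.2).2
    rw [Subgroup.mem_centralizer_singleton_iff]
    have h2 : g.1 * a = h * a * h⁻¹ * g.1 := (mul_inv_eq_iff_eq_mul.1 this)
    rw [mul_assoc, h2]; group
  · have := Subgroup.mem_centralizer_singleton_iff.1 c.2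
    rw [mem_filter]
    refine ⟨mem_univ _, ?_⟩
    rw [mul_assoc h, this]; group
  · simp
  · simp

section Conjugation

variable {α : Type} [DecidableEq α] [Fintype α]

theorem cycleType_of_transitive {γ : Perm α} (hγ : ∀ x y, SameCycle γ x y)
    (hc : 2 ≤ Fintype.card α) : γ.cycleType = {Fintype.card α} := by
  have : Nontrivial α := Fintype.one_lt_card_iff_nontrivial.1 hc
  obtain ⟨x, y, hxy⟩ := exists_pair_ne α
  have hne : ∀ z, γ z ≠ z := by
    intro z hz
    obtain ⟨w, hw⟩ := exists_ne z
    exact hw ((hγ z w).eq_of_left hz).symm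
  have hcyc : γ.IsCycle := ⟨x, hne x, fun z _ => hγ x z⟩
  rw [hcyc.cycleType, ← Finset.card_univ]
  congr 2
  ext z
  simp [hne z]

theorem cycleType_of_pairing {p : Perm α} (hp : ∀ x, p (p x) = x) (hp' : ∀ x, p x ≠ x) {n : ℕ}
    (hc : Fintype.card α = 2 * n) : p.cycleType = Multiset.replicate n 2 := by
  have h2 : p ^ 2 = 1 := by ext x; simp [pow_two, hp]
  have h := cycleType_of_pow_prime_eq_one h2
  have hs : #p.support = 2 * n := by
    rw [← hc, ← Finset.card_univ]
    congr 1
    ext z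
    simp [hp' z]
  rw [← sum_cycleType, h] at hs
  simp only [Multiset.sum_replicate, smul_eq_mul] at hs
  rw [h]
  congr 1
  omega

theorem card_centralizer_of_transitive {γ : Perm α} (hγ : ∀ x y, SameCycle γ x y)
    (hc : 2 ≤ Fintype.card α) :
    Nat.card (Subgroup.centralizer {γ}) = Fintype.card α := by
  rw [nat_card_centralizer, cycleType_of_transitive hγ hc]
  simp

theorem card_centralizer_of_pairing {p : Perm α} (hp : ∀ x, p (p x) = x) (hp' : ∀ x, p x ≠ x)
    {n : ℕ} (hn : n ≠ 0) (hc : Fintype.card α = 2 * n) :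
    Nat.card (Subgroup.centralizer {p}) = 2 ^ n * n ! := by
  rw [nat_card_centralizer, cycleType_of_pairing hp hp' hc, hc]
  simp [Multiset.toFinset_replicate, hn, mul_comm n 2]

theorem isConj_iff_transitive {γ δ : Perm α} (hγ : ∀ x y, SameCycle γ x y)
    (hc : 2 ≤ Fintype.card α) : IsConj γ δ ↔ ∀ x y, SameCycle δ x y := by
  refine ⟨fun h x y => ?_, fun h => ?_⟩
  · obtain ⟨g, rfl⟩ := isConj_iff.1 h
    rw [sameCycle_conj]
    exact hγ _ _
  · rw [isConj_iff_cycleType_eq, cycleType_of_transitive hγ hc, cycleType_of_transitive h hc]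

theorem isConj_iff_pairing {p q : Perm α} (hp : ∀ x, p (p x) = x) (hp' : ∀ x, p x ≠ x) {n : ℕ}
    (hc : Fintype.card α = 2 * n) :
    IsConj p q ↔ (∀ x, q (q x) = x) ∧ ∀ x, q x ≠ x := by
  refine ⟨fun h => ?_, fun h => ?_⟩
  · obtain ⟨g, rfl⟩ := isConj_iff.1 h
    refine ⟨fun x => by simp [hp], fun x hx => hp' (g⁻¹ x) ?_⟩
    rw [Perm.mul_apply, Perm.mul_apply] at hx
    exact Perm.eq_inv_iff_eq.2 hx
  · rw [isConj_iff_cycleType_eq, cycleType_of_pairing hp hp' hc, cycleType_of_pairing h.1 h.2 hc]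

/-- Both sides are the sum of `N ^ cycleCount (γ * (g * p * g⁻¹))` over the whole group, grouped by
the conjugates of `γ` or by those of `p`. The prefactors are the orders of the centralizers. -/
theorem card_mul_transitiveCycleSum_eq {γ p : Perm α} (hγ : ∀ x y, SameCycle γ x y)
    (hp : ∀ x, p (p x) = x) (hp' : ∀ x, p x ≠ x) {n : ℕ} (hn : n ≠ 0)
    (hc : Fintype.card α = 2 * n) {s : Finset (Perm α)}
    (hs : ∀ q, q ∈ s ↔ (∀ x, q (q x) = x) ∧ ∀ x, q x ≠ x) (N : ℕ) :
    (2 * n : ℕ) * transitiveCycleSum p N =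
      (2 ^ n * n ! : ℕ) * ∑ q ∈ s, (N : ℤ) ^ cycleCount (γ * q) := by
  classical
  have h2 : 2 ≤ Fintype.card α := by omega
  have h3 := sum_conj_eq_card_centralizer_mul γ (fun b => (N : ℤ) ^ cycleCount (p * b))
  have h4 := sum_conj_eq_card_centralizer_mul p (fun b => (N : ℤ) ^ cycleCount (γ * b))
  rw [card_centralizer_of_transitive hγ h2, hc] at h3
  rw [card_centralizer_of_pairing hp hp' hn hc] at h4
  simp only [isConj_iff_transitive hγ h2] at h3
  have h5 : ({b | IsConj p b} : Finset (Perm α)) = s := by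
    ext q; rw [hs, mem_filter, isConj_iff_pairing hp hp' hc]; simp
  rw [h5] at h4
  rw [transitiveCycleSum, ← h3, ← h4, ← Equiv.sum_comp (Equiv.inv (Perm α))]
  refine Finset.sum_congr rfl fun g _ => ?_
  have : γ * (g * p * g⁻¹) = (γ * g) * (p * (g⁻¹ * γ * g)) * (γ * g)⁻¹ := by group
  rw [this, cycleCount_conj]
  simp

end Conjugation

theorem transitiveCycleSum_permCongr {α β : Type} [DecidableEq α] [Fintype α] [DecidableEq β]
    [Fintype β] (e : α ≃ β) (p : Perm α) (N : ℕ) :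
    transitiveCycleSum (e.permCongr p) N = transitiveCycleSum p N := by
  classical
  rw [transitiveCycleSum, transitiveCycleSum, Finset.sum_filter, Finset.sum_filter,
    ← Equiv.sum_comp e.permCongr]
  refine Finset.sum_congr rfl fun γ _ => ?_
  have h1 : (∀ x y, SameCycle (e.permCongr γ) x y) ↔ ∀ x y, SameCycle γ x y := by
    rw [← e.forall_congr_right]
    refine forall_congr' fun x => ?_
    rw [← e.forall_congr_right]
    exact forall_congr' fun y => sameCycle_permCongr e γ x y
  have h2 : e.permCongr p * e.permCongr γ = e.permCongr (p * γ) :=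
    (map_mul e.permCongrHom p γ).symm
  simp only [h1, h2, cycleCount_permCongr]

open PowerSeries in
theorem sum_pow_cycleCount_finRotate_mul (k : ℕ) {N : ℕ} (hN : 0 < N) :
    open Classical in
    (∑ p : Perm (Fin (2 * (k + 1))) with IsPairing p,
      (N : ℚ) ^ cycleCount (finRotate (2 * (k + 1)) * p)) =
      (2 * (k + 1) - 1)‼ * coeff N (X * (1 + X) ^ (k + 1) * geomSeries ^ (k + 3)) := by
  classical
  let e : Fin (k + 1) × Bool ≃ Fin (2 * (k + 1)) :=
    Fintype.equivOfCardEq (by simp [mul_comm])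
  have hrot : ∀ x y, SameCycle (finRotate (2 * (k + 1))) x y := fun x y => by
    have hs := support_finRotate_of_le (n := 2 * (k + 1)) (by omega)
    refine (isCycle_finRotate_of_le (by omega)).sameCycle ?_ ?_ <;>
    · rw [← mem_support, hs]; exact mem_univ _
  have h := card_mul_transitiveCycleSum_eq (p := e.permCongr (flip (Fin (k + 1)))) hrot
    (fun x => by simp [Equiv.permCongr_apply, flip_flip])
    (fun x hx => flip_ne (e.symm x) (by
      rw [Equiv.permCongr_apply] at hx; exact (Equiv.eq_symm_apply e).2 hx))
    (n := k + 1) (by omega) (by simp)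
    (s := {p | IsPairing p}) (fun p => by rw [mem_filter, IsPairing]; simp) N
  rw [transitiveCycleSum_permCongr] at h
  have h' := congrArg (Int.cast (R := ℚ)) h
  rw [Int.cast_mul, Int.cast_mul, transitiveCycleSum_flip k hN] at h'
  -- The quotient of `(2d)!` by the order `2^d d!` of the centralizer is the number `(2d-1)!!` of
  -- pairings.
  have hf : (2 * (k + 1))! = (2 ^ (k + 1) * (k + 1)!) * (2 * (k + 1) - 1)‼ := by
    rw [← Nat.doubleFactorial_two_mul]
    exact Nat.factorial_eq_mul_doubleFactorial (2 * k + 1)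
  have hf2 : (2 * (k + 1))! = (2 * (k + 1)) * (2 * k + 1)! := Nat.factorial_succ (2 * k + 1)
  have hf3 : ((2 * (k + 1) : ℕ) : ℚ) * (2 * k + 1)! =
      ((2 ^ (k + 1) * (k + 1)! : ℕ) : ℚ) * (2 * (k + 1) - 1)‼ := by
    exact_mod_cast hf2.symm.trans hf
  have hpos : ((2 ^ (k + 1) * (k + 1)! : ℕ) : ℚ) ≠ 0 := by positivity
  apply mul_left_cancel₀ hpos
  rw [← mul_assoc, ← hf3, mul_assoc]
  refine Eq.trans ?_ (h'.symm.trans ?_)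
  · push_cast
    rfl
  · push_cast
    rfl

end HarerZagier

/-! ### Passage to the hyperbolic power series. -/

namespace HarerZagier

open Finset PowerSeries

theorem derivative_sinhSeries : d⁄dX ℚ sinhSeries = coshSeries := by
  ext k
  rw [coeff_derivative, sinhSeries, coshSeries, coeff_mk, coeff_mk]
  by_cases h : Even k
  · rw [if_pos h, if_pos h.add_one, Nat.factorial_succ]
    have : (k ! : ℚ) ≠ 0 := by positivity
    push_cast
    field_simp
  · rw [if_neg h, if_neg (by rw [Nat.odd_add_one, Nat.not_odd_iff_even]; exact h), zero_mul]

theorem derivative_coshSeries : d⁄dX ℚ coshSeries = sinhSeries := by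
  ext k
  rw [coeff_derivative, sinhSeries, coshSeries, coeff_mk, coeff_mk]
  by_cases h : Odd k
  · rw [if_pos h, if_pos h.add_one, Nat.factorial_succ]
    have : (k ! : ℚ) ≠ 0 := by positivity
    push_cast
    field_simp
  · rw [if_neg h, if_neg (by rw [Nat.even_add_one, Nat.not_even_iff_odd]; exact h), zero_mul]

theorem coshSeries_add_sinhSeries : coshSeries + sinhSeries = PowerSeries.exp ℚ := by
  ext k
  rw [map_add, sinhSeries, coshSeries, coeff_mk, coeff_mk, coeff_exp]
  by_cases h : Even k
  · rw [if_pos h, if_neg (Nat.not_odd_iff_even.2 h)]; simp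
  · rw [if_neg h, if_pos (Nat.not_even_iff_odd.1 h)]; simp

theorem constantCoeff_sinhSeries : constantCoeff sinhSeries = 0 := by
  rw [← coeff_zero_eq_constantCoeff_apply, sinhSeries, coeff_mk]; simp

theorem constantCoeff_coshSeries : constantCoeff coshSeries = 1 := by
  rw [← coeff_zero_eq_constantCoeff_apply, coshSeries, coeff_mk]; simp

theorem constantCoeff_xDivSinh : constantCoeff xDivSinh = 1 := by
  have h : constantCoeff sinhDivX = 1 := by
    rw [← coeff_zero_eq_constantCoeff_apply, sinhDivX, coeff_mk, sinhSeries, coeff_mk]; simp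
  simp [xDivSinh, h]

theorem coshSeries_sq_sub_sinhSeries_sq : coshSeries ^ 2 - sinhSeries ^ 2 = 1 := by
  refine derivative.ext ?_ ?_
  · rw [map_sub, Derivation.leibniz_pow, Derivation.leibniz_pow, derivative_coshSeries,
      derivative_sinhSeries, Derivation.map_one_eq_zero]
    simp only [smul_eq_mul, nsmul_eq_mul, Nat.add_one_sub_one, pow_one]
    ring
  · simp [constantCoeff_sinhSeries, constantCoeff_coshSeries]

theorem exp_sq_sub_one : PowerSeries.exp ℚ ^ 2 - 1 = 2 * sinhSeries * PowerSeries.exp ℚ := by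
  rw [← coshSeries_add_sinhSeries]
  linear_combination coshSeries_sq_sub_sinhSeries_sq

theorem exp_sq_add_one : PowerSeries.exp ℚ ^ 2 + 1 = 2 * coshSeries * PowerSeries.exp ℚ := by
  rw [← coshSeries_add_sinhSeries]
  linear_combination -coshSeries_sq_sub_sinhSeries_sq

theorem X_mul_derivative_xDivTanh : X * d⁄dX ℚ xDivTanh = xDivTanh - xDivSinh ^ 2 := by
  have h1 := congrArg (d⁄dX ℚ) xDivTanh_mul_sinh
  simp only [Derivation.leibniz, derivative_X, derivative_sinhSeries, derivative_coshSeries,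
    smul_eq_mul] at h1
  have h2 := xDivSinh_mul_sinh
  have h3 := coshSeries_sq_sub_sinhSeries_sq
  rw [xDivTanh] at h1 ⊢
  linear_combination xDivSinh * h1 - d⁄dX ℚ (xDivSinh * coshSeries) * h2 -
    xDivSinh ^ 2 * h3 - (xDivSinh * sinhSeries) * h2

/-- With `T = u/tanh u`, the series times `n + 1` equals `(n + 1) T^(n+1) - u (T^(n+1))'`, and the
operator `(n + 1) - u d/du` kills the coefficient of degree `n + 1`. -/
theorem coeff_xDivSinh_sq_mul_xDivTanh_pow (n : ℕ) :
    coeff (n + 1) (xDivSinh ^ 2 * xDivTanh ^ n) = 0 := by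
  have h1 : xDivSinh ^ 2 = xDivTanh - X * d⁄dX ℚ xDivTanh := by
    rw [X_mul_derivative_xDivTanh]; ring
  have h2 : C ((n : ℚ) + 1) * (xDivSinh ^ 2 * xDivTanh ^ n) =
      C ((n : ℚ) + 1) * xDivTanh ^ (n + 1) - X * d⁄dX ℚ (xDivTanh ^ (n + 1)) := by
    rw [h1, Derivation.leibniz_pow, Nat.add_sub_cancel, nsmul_eq_mul, smul_eq_mul]
    simp only [map_add, map_natCast, map_one]
    push_cast
    ring
  have h3 := congrArg (coeff (n + 1)) h2
  rw [map_sub, coeff_C_mul, coeff_C_mul, coeff_succ_X_mul, coeff_derivative] at h3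
  have h4 : ((n : ℚ) + 1) ≠ 0 := by positivity
  apply mul_left_cancel₀ h4
  rw [h3]; ring

/-- Raising `n` by one multiplies the series by `(1 + X) / (1 - X)`. -/
theorem coeff_X_mul_pow_mul_geomSeries_pow_succ (n N : ℕ) :
    coeff (N + 1) (X * (1 + X) ^ (n + 1) * geomSeries ^ (n + 3)) -
      coeff N (X * (1 + X) ^ (n + 1) * geomSeries ^ (n + 3)) =
    coeff (N + 1) (X * (1 + X) ^ n * geomSeries ^ (n + 2)) +
      coeff N (X * (1 + X) ^ n * geomSeries ^ (n + 2)) := by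
  have h : X * (1 + X) ^ (n + 1) * geomSeries ^ (n + 3) -
      X * (X * (1 + X) ^ (n + 1) * geomSeries ^ (n + 3)) =
      X * (1 + X) ^ n * geomSeries ^ (n + 2) +
        X * (X * (1 + X) ^ n * geomSeries ^ (n + 2)) := by
    linear_combination (X * (1 + X) ^ (n + 1) * geomSeries ^ (n + 2)) * geomSeries_mul
  have h2 := congrArg (coeff (N + 1)) h
  rwa [map_sub, map_add, coeff_succ_X_mul, coeff_succ_X_mul] at h2

/-- The same recurrence, now from `(e^(2u) - 1) · u/tanh u = u (e^(2u) + 1)`. -/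
theorem coeff_exp_pow_mul_succ (n N : ℕ) :
    coeff (n + 2) (PowerSeries.exp ℚ ^ (2 * (N + 1)) * (xDivSinh ^ 2 * xDivTanh ^ (n + 1))) -
      coeff (n + 2) (PowerSeries.exp ℚ ^ (2 * N) * (xDivSinh ^ 2 * xDivTanh ^ (n + 1))) =
    coeff (n + 1) (PowerSeries.exp ℚ ^ (2 * (N + 1)) * (xDivSinh ^ 2 * xDivTanh ^ n)) +
      coeff (n + 1) (PowerSeries.exp ℚ ^ (2 * N) * (xDivSinh ^ 2 * xDivTanh ^ n)) := by
  rw [← map_sub, ← map_add]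
  refine Eq.trans ?_ (coeff_succ_X_mul (n + 1) _)
  congr 1
  have h1 := exp_sq_sub_one
  have h2 := exp_sq_add_one
  have h3 := xDivTanh_mul_sinh
  rw [mul_add 2, mul_one, pow_add]
  linear_combination (PowerSeries.exp ℚ ^ (2 * N) * xDivSinh ^ 2 * xDivTanh ^ n) *
    (xDivTanh * h1 + 2 * PowerSeries.exp ℚ * h3 - X * h2)

theorem coeff_one_exp_pow_mul_succ (N : ℕ) :
    coeff 1 (PowerSeries.exp ℚ ^ (2 * (N + 1)) * (xDivSinh ^ 2 * xDivTanh ^ 0)) -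
      coeff 1 (PowerSeries.exp ℚ ^ (2 * N) * (xDivSinh ^ 2 * xDivTanh ^ 0)) = 2 := by
  have h1 : PowerSeries.exp ℚ ^ (2 * (N + 1)) * (xDivSinh ^ 2 * xDivTanh ^ 0) -
      PowerSeries.exp ℚ ^ (2 * N) * (xDivSinh ^ 2 * xDivTanh ^ 0) =
      X * (2 * (PowerSeries.exp ℚ ^ (2 * N + 1) * xDivSinh)) := by
    rw [mul_add 2, mul_one, pow_add]
    linear_combination (PowerSeries.exp ℚ ^ (2 * N) * xDivSinh ^ 2) * exp_sq_sub_one +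
      (2 * PowerSeries.exp ℚ ^ (2 * N + 1) * xDivSinh) * xDivSinh_mul_sinh
  rw [← map_sub, h1]
  refine (coeff_succ_X_mul 0 _).trans ?_
  rw [coeff_zero_eq_constantCoeff_apply, map_mul, map_mul, map_pow, constantCoeff_xDivSinh, map_ofNat]
  simp

/-- Both sides obey the same recurrence in `n` and `N`, vanish at `N = 0`, and equal `N` at `n = 0`.
-/
theorem coeff_X_mul_pow_mul_geomSeries_pow (n N : ℕ) :
    coeff N (X * (1 + X) ^ n * geomSeries ^ (n + 2)) =
      1 / 2 * coeff (n + 1)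
        (PowerSeries.exp ℚ ^ (2 * N) * (xDivSinh ^ 2 * xDivTanh ^ n)) := by
  induction n generalizing N with
  | zero =>
    induction N with
    | zero =>
      rw [mul_zero, pow_zero (PowerSeries.exp ℚ), one_mul, coeff_xDivSinh_sq_mul_xDivTanh_pow]; simp
    | succ N ih =>
      have h1 := coeff_one_exp_pow_mul_succ N
      have h2 : ∀ M, coeff M (X * (1 + X) ^ 0 * geomSeries ^ (0 + 2) : ℚ⟦X⟧) = M := by
        intro M
        cases M with
        | zero => simp
        | succ M =>
          rw [pow_zero, mul_one, coeff_succ_X_mul, geomSeries,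
            mk_one_pow_eq_mk_choose_add ℚ 1, coeff_mk, Nat.choose_one_right]
          push_cast; ring
      rw [h2] at ih ⊢
      rw [zero_add] at ih ⊢
      push_cast
      linear_combination ih - 1 / 2 * h1
  | succ n ihn =>
    induction N with
    | zero =>
      rw [mul_zero, pow_zero (PowerSeries.exp ℚ), one_mul, coeff_xDivSinh_sq_mul_xDivTanh_pow]; simp
    | succ N ih =>
      have h1 := coeff_exp_pow_mul_succ n N
      have h2 := coeff_X_mul_pow_mul_geomSeries_pow_succ n N
      rw [ihn, ihn] at h2
      linear_combination ih + h2 - 1 / 2 * h1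

theorem coeff_exp_pow_mul (n N : ℕ) (H : ℚ⟦X⟧) :
    coeff n (PowerSeries.exp ℚ ^ (2 * N) * H) =
      ∑ q ∈ antidiagonal n, 2 ^ q.1 / (q.1)! * coeff q.2 H * (N : ℚ) ^ q.1 := by
  rw [coeff_mul]
  refine Finset.sum_congr rfl fun q _ => ?_
  rw [exp_pow_eq_rescale_exp, coeff_rescale, coeff_exp]
  simp only [map_div₀, map_one, map_natCast]
  push_cast
  ring

open Classical in
theorem card_pairings_cycleCount (k v : ℕ) (hv : v ≤ k + 2) :
    (#{p : Equiv.Perm (Fin (2 * (k + 1))) | IsPairing p ∧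
      cycleCount (finRotate (2 * (k + 1)) * p) = v} : ℚ) =
      (2 * (k + 1) - 1)‼ * (2 ^ v / 2) / v ! *
        coeff (k + 2 - v) (xDivSinh ^ 2 * xDivTanh ^ (k + 1)) := by
  let P : Polynomial ℚ := ∑ p : Equiv.Perm (Fin (2 * (k + 1))) with IsPairing p,
    Polynomial.X ^ cycleCount (finRotate (2 * (k + 1)) * p)
  let Q : Polynomial ℚ := ∑ q ∈ antidiagonal (k + 2),
    Polynomial.C (((2 * (k + 1) - 1)‼ : ℚ) * ((1 / 2 : ℚ) * ((2 : ℚ) ^ q.1 / ((q.1)! : ℚ) *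
      coeff q.2 (xDivSinh ^ 2 * xDivTanh ^ (k + 1))))) * Polynomial.X ^ q.1
  have hPQ : P = Q := by
    -- Both polynomials agree at all positive integers, so their coefficients of degree `v` may be
    -- compared.
    refine Polynomial.eq_of_infinite_eval_eq P Q
      (((Set.infinite_of_injective_forall_mem (f := fun N : ℕ => ((N + 1 : ℕ) : ℚ)))
        fun a b h => by simpa using h) fun N => ?_)
    rw [Set.mem_ofPred_eq]
    simp only [P, Q, Polynomial.eval_finsetSum, Polynomial.eval_mul, Polynomial.eval_pow,
      Polynomial.eval_X, Polynomial.eval_C]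
    rw [sum_pow_cycleCount_finRotate_mul k N.succ_pos, coeff_X_mul_pow_mul_geomSeries_pow,
      coeff_exp_pow_mul, Finset.mul_sum, Finset.mul_sum]
    exact Finset.sum_congr rfl fun q _ => by ring
  have hc := congrArg (fun R => Polynomial.coeff R v) hPQ
  simp only [P, Q, Polynomial.finsetSum_coeff, Polynomial.coeff_C_mul,
    Polynomial.coeff_X_pow] at hc
  rw [Finset.sum_boole, Finset.filter_filter, Finset.sum_eq_single (v, k + 2 - v)] at hc
  · simp only [eq_comm (a := v)] at hc
    rw [hc]
    simp only [if_true]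
    ring
  · rintro ⟨a, b⟩ hq hne
    rw [HasAntidiagonal.mem_antidiagonal] at hq
    have : v ≠ a := by
      rintro rfl
      apply hne
      ext
      · rfl
      · simp only at hq ⊢; omega
    simp [this]
  · intro h
    exact absurd (HasAntidiagonal.mem_antidiagonal.2 (by simp only; omega)) h

end HarerZagier

/-! ### The cells of the glued surface. -/

namespace HarerZagier

open Equiv Equiv.Perm Finset

section Topology

variable {n : ℕ}

theorem sidePoint_one (hn : 0 < n) (i : Fin (2 * n)) :
    sidePoint n i 1 = sidePoint n (finRotate (2 * n) i) 0 := by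
  obtain ⟨m, hm⟩ : ∃ m, 2 * n = m + 1 := ⟨2 * n - 1, by omega⟩
  have hval : ((finRotate (2 * n) i : Fin (2 * n)) : ℕ) =
      if (i : ℕ) + 1 = 2 * n then 0 else (i : ℕ) + 1 := by
    have h : ∀ (q : ℕ) (hq : q = m + 1) (j : Fin q),
        ((finRotate q j : Fin q) : ℕ) = if (j : ℕ) + 1 = q then 0 else (j : ℕ) + 1 := by
      rintro q rfl j
      rw [coe_finRotate]
      have : j = Fin.last m ↔ (j : ℕ) + 1 = m + 1 := by rw [Fin.ext_iff, Fin.val_last]; omega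
      simp only [this]
    exact h _ hm i
  apply Subtype.ext
  have hn' : ((2 * n : ℕ) : ℝ) ≠ 0 := by positivity
  simp only [sidePoint]
  rw [hval]
  split_ifs with h
  · have h1 : (2 * Real.pi * ((i : ℕ) + 1) / (2 * n) : ℝ) = 2 * Real.pi := by
      have : ((i : ℕ) : ℝ) + 1 = 2 * n := by exact_mod_cast h
      rw [this]
      push_cast at hn'
      field_simp
    rw [h1]
    simp
  · push_cast
    simp

theorem sidePoint_injective {i j : Fin (2 * n)} {s t : ℝ} (hs : s ∈ Set.Ico (0 : ℝ) 1)
    (ht : t ∈ Set.Ico (0 : ℝ) 1) (h : sidePoint n i s = sidePoint n j t) : i = j ∧ s = t := by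
  have hn : 0 < 2 * n := i.pos
  have hn' : (0 : ℝ) < 2 * n := by exact_mod_cast hn
  have h1 := congrArg Subtype.val h
  simp only [sidePoint] at h1
  rw [Complex.exp_eq_exp_iff_exists_int] at h1
  obtain ⟨k, hk⟩ := h1
  have h2 : 2 * Real.pi * ((i : ℕ) + s) / (2 * n) =
      2 * Real.pi * ((j : ℕ) + t) / (2 * n) + k * (2 * Real.pi) := by
    have h3 : (((2 * Real.pi * ((i : ℕ) + s) / (2 * n) : ℝ) : ℂ)) * Complex.I =
      ((2 * Real.pi * ((j : ℕ) + t) / (2 * n) + k * (2 * Real.pi) : ℝ) : ℂ) * Complex.I := by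
      rw [hk]; push_cast; ring
    exact_mod_cast mul_right_cancel₀ Complex.I_ne_zero h3
  have h4 : ((i : ℕ) : ℝ) + s = (j : ℕ) + t + k * (2 * n) := by
    have hn0 : (n : ℝ) ≠ 0 := by intro h0; simp [h0] at hn'
    field_simp at h2
    linarith
  have hi : ((i : ℕ) : ℝ) + 1 ≤ 2 * n := by exact_mod_cast i.2
  have hj : ((j : ℕ) : ℝ) + 1 ≤ 2 * n := by exact_mod_cast j.2
  have hi0 : (0 : ℝ) ≤ (i : ℕ) := Nat.cast_nonneg _
  have hj0 : (0 : ℝ) ≤ (j : ℕ) := Nat.cast_nonneg _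
  obtain ⟨hs0, hs1⟩ := hs
  obtain ⟨ht0, ht1⟩ := ht
  have hk0 : k = 0 := by
    have hk1 : (k : ℝ) < 1 := by
      by_contra hc
      push Not at hc
      nlinarith
    have hk2 : (-1 : ℝ) < k := by
      by_contra hc
      push Not at hc
      nlinarith
    have h5 : k < 1 := by exact_mod_cast hk1
    have h6 : -1 < k := by exact_mod_cast hk2
    omega
  rw [hk0] at h4
  have hij : (i : ℕ) = j := by
    have h5 : ((i : ℕ) : ℝ) < (j : ℕ) + 1 := by push_cast at h4; linarith
    have h6 : ((j : ℕ) : ℝ) < (i : ℕ) + 1 := by push_cast at h4; linarith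
    have h7 : (i : ℕ) < j + 1 := by exact_mod_cast h5
    have h8 : (j : ℕ) < i + 1 := by exact_mod_cast h6
    omega
  refine ⟨Fin.ext hij, ?_⟩
  rw [hij] at h4
  push_cast at h4
  linarith

/-- A function on the polygon that takes equal values at identified points takes equal values at points
with the same image in the surface. -/
theorem eq_of_quot_mk_eq {β : Type*} {p : Perm (Fin (2 * n))} (f : Polygon → β)
    (hf : ∀ x y, GlueRel p x y → f x = f y) {x y : Polygon}
    (h : Quot.mk (GlueRel p) x = Quot.mk (GlueRel p) y) : f x = f y :=
  congrArg (Quot.lift f hf) h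

/-- A function on the corners of the polygon, extended by `none` to the polygon. -/
noncomputable def cornerExtension {β : Type*} (f : Fin (2 * n) → β) (x : Polygon) : Option β :=
  open Classical in if h : ∃ i, x = sidePoint n i 0 then some (f h.choose) else none

theorem cornerExtension_corner {β : Type*} (f : Fin (2 * n) → β) (i : Fin (2 * n)) :
    cornerExtension f (sidePoint n i 0) = some (f i) := by
  have h : ∃ j, sidePoint n i 0 = sidePoint n j 0 := ⟨i, rfl⟩
  rw [cornerExtension, dif_pos h]
  rw [← (sidePoint_injective (by simp) (by simp) h.choose_spec).1]

theorem cornerExtension_of_mem_Ioo {β : Type*} (f : Fin (2 * n) → β) (i : Fin (2 * n)) {t : ℝ}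
    (ht : t ∈ Set.Ioo (0 : ℝ) 1) : cornerExtension f (sidePoint n i t) = none := by
  rw [cornerExtension, dif_neg]
  rintro ⟨j, hj⟩
  have := (sidePoint_injective (Set.Ioo_subset_Ico_self ht) (by simp) hj).2
  exact ht.1.ne' this

/-- A function on the sides of the polygon, extended by `none` to the polygon. -/
noncomputable def sideExtension {β : Type*} (f : Fin (2 * n) → β) (x : Polygon) : Option β :=
  open Classical in
  if h : ∃ i, ∃ t ∈ Set.Ioo (0 : ℝ) 1, x = sidePoint n i t then some (f h.choose) else none

theorem sideExtension_of_mem_Ioo {β : Type*} (f : Fin (2 * n) → β) (i : Fin (2 * n)) {t : ℝ}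
    (ht : t ∈ Set.Ioo (0 : ℝ) 1) : sideExtension f (sidePoint n i t) = some (f i) := by
  have h : ∃ j, ∃ s ∈ Set.Ioo (0 : ℝ) 1, sidePoint n i t = sidePoint n j s := ⟨i, t, ht, rfl⟩
  rw [sideExtension, dif_pos h]
  obtain ⟨s, hs, he⟩ := h.choose_spec
  rw [← (sidePoint_injective (Set.Ioo_subset_Ico_self ht) (Set.Ioo_subset_Ico_self hs) he).1]

theorem sideExtension_corner {β : Type*} (f : Fin (2 * n) → β) (i : Fin (2 * n)) :
    sideExtension f (sidePoint n i 0) = none := by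
  rw [sideExtension, dif_neg]
  rintro ⟨j, t, ht, he⟩
  have := (sidePoint_injective (by simp) (Set.Ioo_subset_Ico_self ht) he).2
  exact ht.1.ne this

/-- An endpoint `t = 1` is the initial corner of the next side, so gluing at endpoints links corners
by one step of `finRotate * p`; interior points meet only interior points. -/
theorem GlueRel.cases {p : Perm (Fin (2 * n))} (hp : IsPairing p) {x y : Polygon}
    (h : GlueRel p x y) :
    (∃ i, x = sidePoint n i 0 ∧ y = sidePoint n ((finRotate (2 * n) * p) i) 0) ∨
    (∃ i, y = sidePoint n i 0 ∧ x = sidePoint n ((finRotate (2 * n) * p) i) 0) ∨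
    ∃ i, ∃ t ∈ Set.Ioo (0 : ℝ) 1, x = sidePoint n i t ∧ y = sidePoint n (p i) (1 - t) := by
  obtain ⟨i, t, ht, hx, hy⟩ := h
  have hn : 0 < n := by have := i.pos; omega
  rcases eq_or_lt_of_le ht.1 with h0 | h0
  · left
    refine ⟨i, by rw [hx, h0], ?_⟩
    rw [hy, ← h0, sub_zero, sidePoint_one hn, Perm.mul_apply]
  rcases eq_or_lt_of_le ht.2 with h1 | h1
  · right; left
    refine ⟨p i, by rw [hy, h1, sub_self], ?_⟩
    rw [hx, h1, sidePoint_one hn, Perm.mul_apply, hp.1]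
  · exact Or.inr (Or.inr ⟨i, t, ⟨h0, h1⟩, hx, hy⟩)

theorem one_sub_mem_Ioo {t : ℝ} (ht : t ∈ Set.Ioo (0 : ℝ) 1) : 1 - t ∈ Set.Ioo (0 : ℝ) 1 :=
  ⟨by linarith [ht.2], by linarith [ht.1]⟩

/-- The cycle containing a corner, extended by `none` to all other points, is invariant under gluing
and therefore separates the vertices. -/
theorem quot_mk_corner_eq_iff {p : Perm (Fin (2 * n))} (hp : IsPairing p) (i j : Fin (2 * n)) :
    Quot.mk (GlueRel p) (sidePoint n i 0) = Quot.mk (GlueRel p) (sidePoint n j 0) ↔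
      SameCycle (finRotate (2 * n) * p) i j := by
  have hn : 0 < n := by have := i.pos; omega
  constructor
  · intro h
    have := eq_of_quot_mk_eq (cornerExtension
      (Quotient.mk (SameCycle.setoid (finRotate (2 * n) * p)))) ?_ h
    · rw [cornerExtension_corner, cornerExtension_corner, Option.some_inj] at this
      exact Quotient.exact this
    · intro x y hxy
      have hstep : ∀ k, Quotient.mk (SameCycle.setoid (finRotate (2 * n) * p)) k =
          Quotient.mk _ ((finRotate (2 * n) * p) k) := fun k =>
        Quotient.sound (s := SameCycle.setoid (finRotate (2 * n) * p))
          (sameCycle_apply_right.2 (SameCycle.refl _ _))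
      rcases hxy.cases hp with ⟨k, rfl, rfl⟩ | ⟨k, rfl, rfl⟩ | ⟨k, t, ht, rfl, rfl⟩
      · rw [cornerExtension_corner, cornerExtension_corner, ← hstep]
      · rw [cornerExtension_corner, cornerExtension_corner, ← hstep]
      · rw [cornerExtension_of_mem_Ioo _ _ ht, cornerExtension_of_mem_Ioo _ _ (one_sub_mem_Ioo ht)]
  · intro h
    refine SameCycle.induction_map (f := fun i => Quot.mk (GlueRel p) (sidePoint n i 0)) ?_ h
    intro k
    refine (Quot.sound ⟨k, 0, by simp, rfl, ?_⟩).symm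
    rw [sub_zero, sidePoint_one hn, Perm.mul_apply]

theorem ncard_vertices {p : Perm (Fin (2 * n))} (hp : IsPairing p) :
    (vertices p).ncard = cycleCount (finRotate (2 * n) * p) := by
  rw [cycleCount, ← Nat.card_coe_set_eq, vertices]
  refine Nat.card_congr (Equiv.trans (Setoid.quotientKerEquivRange _).symm
    (Quotient.congr (Equiv.refl _) fun i j => ?_))
  exact quot_mk_corner_eq_iff hp i j

theorem image_side_eq_iff {p : Perm (Fin (2 * n))} (hp : IsPairing p) (i j : Fin (2 * n)) :
    Quot.mk (GlueRel p) '' (sidePoint n i '' Set.Ioo (0 : ℝ) 1) =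
      Quot.mk (GlueRel p) '' (sidePoint n j '' Set.Ioo (0 : ℝ) 1) ↔ j = i ∨ j = p i := by
  constructor
  · intro h
    have hmem : Quot.mk (GlueRel p) (sidePoint n j (1 / 2)) ∈
        Quot.mk (GlueRel p) '' (sidePoint n i '' Set.Ioo (0 : ℝ) 1) := by
      rw [h]
      exact ⟨_, ⟨1 / 2, by norm_num, rfl⟩, rfl⟩
    obtain ⟨_, ⟨t, ht, rfl⟩, he⟩ := hmem
    -- The unordered pair of glued sides is the invariant that separates the edges.
    have := eq_of_quot_mk_eq (sideExtension (fun k => s(k, p k))) ?_ he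
    · rw [sideExtension_of_mem_Ioo _ _ ht, sideExtension_of_mem_Ioo _ _ (by norm_num),
        Option.some_inj, Sym2.eq_iff] at this
      rcases this with h | h
      · exact Or.inl h.1.symm
      · exact Or.inr h.2.symm
    · intro x y hxy
      rcases hxy.cases hp with ⟨k, rfl, rfl⟩ | ⟨k, rfl, rfl⟩ | ⟨k, t, ht, rfl, rfl⟩
      · rw [sideExtension_corner, sideExtension_corner]
      · rw [sideExtension_corner, sideExtension_corner]
      · rw [sideExtension_of_mem_Ioo _ _ ht, sideExtension_of_mem_Ioo _ _ (one_sub_mem_Ioo ht),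
          hp.1, Sym2.eq_swap]
  · have hsub : ∀ k, Quot.mk (GlueRel p) '' (sidePoint n k '' Set.Ioo (0 : ℝ) 1) ⊆
        Quot.mk (GlueRel p) '' (sidePoint n (p k) '' Set.Ioo (0 : ℝ) 1) := by
      rintro k _ ⟨_, ⟨t, ht, rfl⟩, rfl⟩
      exact ⟨_, ⟨1 - t, one_sub_mem_Ioo ht, rfl⟩,
        (Quot.sound ⟨k, t, Set.Ioo_subset_Icc_self ht, rfl, rfl⟩).symm⟩
    rintro (rfl | rfl)
    · rfl
    · refine Set.Subset.antisymm (hsub i) ?_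
      have := hsub (p i)
      rwa [hp.1] at this

theorem ncard_edges {p : Perm (Fin (2 * n))} (hp : IsPairing p) : (edges p).ncard = n := by
  classical
  let F : Fin (2 * n) → Set (Surface p) := fun i =>
    Quot.mk (GlueRel p) '' (sidePoint n i '' Set.Ioo (0 : ℝ) 1)
  have h1 : edges p = ((univ.image F : Finset _) : Set (Set (Surface p))) := by
    rw [coe_image, coe_univ, Set.image_univ]; rfl
  rw [h1, Set.ncard_coe_finset]
  have h2 := Finset.card_eq_sum_card_image F univ
  have h3 : ∀ e ∈ univ.image F, #{i | F i = e} = 2 := by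
    intro e he
    obtain ⟨i, -, rfl⟩ := mem_image.1 he
    have : ({j | F j = F i} : Finset (Fin (2 * n))) = {i, p i} := by
      ext j
      rw [mem_filter, mem_insert, mem_singleton, eq_comm (a := F j)]
      simp only [mem_univ, true_and]
      exact image_side_eq_iff hp i j
    rw [this, card_pair (hp.2 i).symm]
  rw [Finset.sum_congr rfl h3, Finset.sum_const, card_univ, Fintype.card_fin, smul_eq_mul] at h2
  omega

theorem hasGenus_iff {p : Perm (Fin (2 * n))} (hp : IsPairing p) (g : ℕ) :
    HasGenus p g ↔ cycleCount (finRotate (2 * n) * p) + 2 * g = n + 1 := by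
  rw [HasGenus, eulerChar, ncard_vertices hp, ncard_edges hp, faces, Set.ncard_singleton]
  omega

open Classical in
theorem epsilon_eq_card (g n : ℕ) :
    epsilon g n = #{p : Perm (Fin (2 * n)) | IsPairing p ∧
      cycleCount (finRotate (2 * n) * p) + 2 * g = n + 1} := by
  rw [epsilon, ← Set.ncard_coe_finset]
  congr 1
  ext p
  simp only [coe_filter, mem_univ, true_and, Set.mem_ofPred_eq]
  exact and_congr_right fun hp => hasGenus_iff hp g

end Topology

end HarerZagier

theorem theorem1 (g d : ℕ) (hd : 1 ≤ d) :
    (2 * g ≤ d + 1 →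
      (HarerZagier.epsilon g d : ℚ) =
        ((2 * d - 1)‼ : ℚ) * (2 : ℚ) ^ ((d : ℤ) - 2 * (g : ℤ)) / ((d + 1 - 2 * g)! : ℚ) *
          PowerSeries.coeff (2 * g) (HarerZagier.xDivSinh ^ 2 * HarerZagier.xDivTanh ^ d)) ∧
    (d + 1 < 2 * g → HarerZagier.epsilon g d = 0) := by
  classical
  rw [HarerZagier.epsilon_eq_card]
  constructor
  · intro hg
    obtain ⟨k, rfl⟩ : ∃ k, d = k + 1 := ⟨d - 1, by omega⟩
    have h := HarerZagier.card_pairings_cycleCount k (k + 2 - 2 * g) (by omega)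
    have h1 : ∀ c, c + 2 * g = k + 1 + 1 ↔ c = k + 2 - 2 * g := fun c => by omega
    simp only [h1]
    rw [h]
    have h2 : k + 2 - (k + 2 - 2 * g) = 2 * g := by omega
    -- With `d = k + 1` the number of vertices is `k + 2 - 2g`. The exponent `d - 2g` is `-1` when
    -- `2g = d + 1`, hence the integer power.
    have h3 : (2 : ℚ) ^ (k + 2 - 2 * g) / 2 = 2 ^ (((k + 1 : ℕ) : ℤ) - 2 * (g : ℤ)) := by
      rw [div_eq_iff two_ne_zero, ← zpow_natCast, ← zpow_add_one₀ two_ne_zero]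
      congr 1
      omega
    rw [h2, h3]
  · intro hg
    rw [Finset.card_eq_zero, Finset.filter_eq_empty_iff]
    rintro p - ⟨-, h⟩
    omega
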